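/- **Setting.** Let $\mathcal E_1,\mathcal E_2$ be real Hilbert spaces and $\mathcal E=\mathcal E_1\times\mathcal E_2$ with the canonical inner product. Let $f:\mathcal E_1\to\mathbb R$ be convex and differentiable with $\beta$-Lipschitz gradient for some $\beta>0$; let $Q=Q_1+Q_2\subset\mathcal E_2$ be nonempty, with $Q_1$ closed, convex, bounded and $Q_2$ a closed convex cone with polar cone $Q_2^\ominus$; let $K\subset\mathcal E_1$ be nonempty, closed, convex; let $A:\mathcal E_1\to\mathcal E_2$ be bounded linear and $b\in\mathcal E_2$. Write $f^*$ for the Legendre–Fenchel conjugate, $\sigma_C$ for the support function and $\iota_C$ for the $\{0,+\infty\}$-valued indicator of a set $C$, $N_C$ for its normal cone, and $\overline{\mathrm{co}}$ for the closed convex hull. Call $\mu\in\mathcal E$ admissible if $\partial f^*(\mu_1)\neq\varnothing$, $\mu_2\in Q$ and $\sigma_{-K}(\mu_1+A^*\mu_2)$ is finite; assume that an admissible point exists. Let $K^{-1}\subset K$ be compact with $-b\in\operatorname{int}\bigl(Q_2^\ominus-A\,\overline{\mathrm{co}}(K^{-1})\bigr)$; a set is called simple if it is the union of $K^{-1}$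 and a finite set. For $w_1\in\partial f^*(\mu_1')$ let $B_{f^*}(\mu_1,(\mu_1',w_1))=f^*(\mu_1)-f^*(\mu_1')-\langle\mu_1-\mu_1',w_1\rangle$. Let $\tilde f$ be the perspective of $f$, so $\tilde f(x,s)=sf(x/s)$ for $s>0$. For a compact $S\subset\mathcal E_1$ let $\mathcal M(S)$ be the space of signed Radon measures on $S$, $\mathcal M_+(S)$ the set of the nonnegative ones, and $\mathfrak E m=\int_S v\,dm(v)\in\mathcal E_1$. **Algorithm.** Fix $\lambda\in(0,1)$, an admissible $\mu^0$, $w_1^0\in\partial f^*(\mu_1^0)$, $\bar h^{-1}=+\infty$, $\bar\Delta=+\infty$. Iteration $t=0,1,\dots$: * choose $v_1^t\in-\operatorname{argmin}_{v\in K}\langle\mu_1^t+A^*\mu_2^t,v\rangle$ and put $\tilde K^t=\overline{\mathrm{co}}(K^{t-1}\cup\{-v_1^t\})$; * put $\bar h^t=\min\{\bar h^{t-1},\langle\mu_2^t,b\rangle+\langle\mu_1^t,w_1^t\rangle+\langle\mu_1^t+A^*\mu_2^t,v_1^t\rangle-f(w_1^t)\}$; * choose a minimizer $\hat x_1^t$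 of $f(x)+\sigma_Q(Ax-b)$ over $x\in\tilde K^t$, and put $\underline h^t=-f(\hat x_1^t)-\sigma_Q(A\hat x_1^t-b)$, $\Delta^t=\bar h^t-\underline h^t$, $\ell^t=\lambda\bar h^t+(1-\lambda)\underline h^t$; * if $\Delta^t<(1-\lambda)\bar\Delta$, choose a simple $K^t\subset\tilde K^t$ with $\hat x_1^t\in\overline{\mathrm{co}}(K^t)$ and set $\bar\Delta=\Delta^t$; otherwise put $K^t=K^{t-1}\cup\{-v_1^t\}$; * choose a solution $m^t$ of the problem $$(\mathrm M^t)\qquad \min_{m\in-\mathcal M_+(K^t)}\ \tilde f\bigl(-\mathfrak Em+w_1^t,\,1-m(K^t)\bigr)+\tfrac12\bigl(\|\tilde\mu_2\|^2-\operatorname{dist}(\tilde\mu_2,Q)^2\bigr)-\ell^t m(K^t),$$ where $\tilde\mu_2=-A\,\mathfrak Em+m(K^t)b+\mu_2^t$, and put $$w_1^{t+1}=\frac{w_1^t-\mathfrak Em^t}{1-m^t(K^t)},\qquad \mu_1^{t+1}=\nabla f(w_1^{t+1}),\qquad \mu_2^{t+1}=\operatorname{proj}_Q\bigl(\mu_2^t+m^t(K^t)b-A\,\mathfrak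 Em^t\bigr).$$ Let $E^t=\{(x_1,Ax_1): -x_1\in K^t\}$, $\psi(\mu)=f^*(\mu_1)+\iota_Q(\mu_2)+\langle\mu_2,b\rangle$, $Q^t=\{\mu\in\mathcal E:\psi(\mu)+\sigma_{E^t}(\mu)\le\ell^t\}$, and consider the Bregman projection problem $$(\mathrm P^t)\qquad \min_{\mu\in Q^t}\ B_{f^*}(\mu_1,(\mu_1^t,w_1^t))+\tfrac12\|\mu_2-\mu_2^t\|^2 .$$ **Proposition.** Let $t\in\mathbb N$, suppose that the algorithm has been run up to the last step of iteration $t$, and let $m^t$ be any solution of $(\mathrm M^t)$. (i) Up to a shift in value, $(\mathrm M^t)$ is the Fenchel dual of $(\mathrm P^t)$. Precisely, for $(\mu,z)\in\mathcal E\times\mathbb R$ and $\phi\in C(K^t)$ put $$F(\mu,z)=z-\langle\mu_1,w_1^t\rangle+\iota_{\operatorname{epi}f^*}(\mu_1,z)+\tfrac12\|\mu_2\|^2-\langle\mu_2,\mu_2^t\rangle+\iota_Q(\mu_2),$$ $$G(\phi)=\iota_{\{\phi-\ell^t\le0\}}(\phi),\qquad L(\mu,z)=z+\langle\mu_2,b\rangle-\langle\mu_1+A^*\mu_2,\cdot\rangle\in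 C(K^t).$$ The value of $\min_{(\mu,z)}F(\mu,z)+G(L(\mu,z))$ is the value of $(\mathrm P^t)$ plus $c=f^*(\mu_1^t)-\langle\mu_1^t,w_1^t\rangle-\frac12\|\mu_2^t\|^2=-f(w_1^t)-\frac12\|\mu_2^t\|^2$, and $(\mu,z)$ solves it if and only if $z=f^*(\mu_1)$ and $\mu$ solves $(\mathrm P^t)$. Each $m\in\mathcal M(K^t)$ defines by integration an element of $C(K^t)^*$, which determines $m$; at this element the dual objective $F^*(L^*\,\cdot)+G^*(-\,\cdot)$ equals the objective of $(\mathrm M^t)$ if $m\in-\mathcal M_+(K^t)$ and $+\infty$ otherwise, and the dual objective is $+\infty$ at every element of $C(K^t)^*$ that is not given by some $m\in-\mathcal M_+(K^t)$. Moreover $\operatorname{val}(\mathrm M^t)=-\bigl(\operatorname{val}(\mathrm P^t)+c\bigr)$. (ii) Define $w_1^{t+1},\mu^{t+1}$ from $m^t$ by the formulas above. Then: (a) $\mu^{t+1}$ is the unique solution of $(\mathrm P^t)$; (b) $w_1^{t+1}\in\partial f^*(\mu_1^{t+1})$ and $(w_1^t-w_1^{t+1},\,\mu_2^t-\mu_2^{t+1})\in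 N_{Q^t}(\mu^{t+1})$. Moreover, if along the run $\partial\sigma_E(\mu^t)\neq\varnothing$ for all $t$, where $E=\{(x_1,Ax_1):-x_1\in K\}$, and the vectors $v^t=(v_1^t,Av_1^t)$ are bounded uniformly in $t$, then $w_1^t$ is bounded uniformly in $t$. -/

import Mathlib

open MeasureTheory
open scoped Pointwise RealInnerProductSpace MeasureTheory.VectorMeasure

noncomputable section

namespace DLS

/-! ### Convex analysis with values in the extended reals -/

section Convex

open Classical in
/-- The indicator of convex analysis: `0` on `C` and `+∞` elsewhere. -/
def ind {X : Type*} (C : Set X) (x : X) : EReal := if x ∈ C then 0 else ⊤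

/-- The set of points where an extended-real-valued function is finite. -/
def effDom {X : Type*} (F : X → EReal) : Set X := {x | F x ≠ ⊥ ∧ F x ≠ ⊤}

/-- The solutions of `minimize F x` subject to `x ∈ C`. -/
def argminOn {X : Type*} (F : X → EReal) (C : Set X) : Set X := {x | x ∈ C ∧ IsMinOn F C x}

/-- The Legendre–Fenchel conjugate, a function on the topological dual. -/
def fenchelConj {X : Type*} [AddCommGroup X] [Module ℝ X] [TopologicalSpace X]
    (F : X → EReal) (φ : StrongDual ℝ X) : EReal :=
  ⨆ x : X, ((φ x : ℝ) : EReal) - F x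

/-- The objective of the Fenchel–Rockafellar primal problem: `F x + G (L x)`. -/
def fenchelPrimalObj {X Y : Type*} [AddCommGroup X] [Module ℝ X] [TopologicalSpace X]
    [AddCommGroup Y] [Module ℝ Y] [TopologicalSpace Y]
    (F : X → EReal) (G : Y → EReal) (L : X →L[ℝ] Y) (x : X) : EReal :=
  F x + G (L x)

/-- The objective of the Fenchel–Rockafellar dual problem: `F* (L* φ) + G* (-φ)`, where the
adjoint of `L` is precomposition with `L`. -/
def fenchelDualObj {X Y : Type*} [AddCommGroup X] [Module ℝ X] [TopologicalSpace X]
    [AddCommGroup Y] [Module ℝ Y] [TopologicalSpace Y] [IsTopologicalAddGroup Y]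
    (F : X → EReal) (G : Y → EReal) (L : X →L[ℝ] Y) (φ : StrongDual ℝ Y) : EReal :=
  fenchelConj F (φ.comp L) + fenchelConj G (-φ)

variable {H : Type*} [NormedAddCommGroup H] [InnerProductSpace ℝ H]

/-- The support function of `C`. -/
def supportFn (C : Set H) (μ : H) : EReal := ⨆ x ∈ C, ((⟪μ, x⟫ : ℝ) : EReal)

/-- The subdifferential of `F` at `x`. -/
def subdiff (F : H → EReal) (x : H) : Set H :=
  {g | ∀ y, F x + ((⟪g, y - x⟫ : ℝ) : EReal) ≤ F y}

/-- The normal cone of `C` at `x`, empty if `x ∉ C`. -/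
def normalCone (C : Set H) (x : H) : Set H :=
  {g | x ∈ C ∧ ∀ y ∈ C, ⟪g, y - x⟫ ≤ 0}

/-- The polar cone of `C`. -/
def polarCone (C : Set H) : Set H := {x | ∀ μ ∈ C, ⟪μ, x⟫ ≤ 0}

open Classical in
/-- The Bregman distance `B_F (μ, (μ', w))`. -/
def bregman (F : H → EReal) (μ μ' w : H) : EReal :=
  if w ∈ subdiff F μ' then F μ - F μ' - ((⟪μ - μ', w⟫ : ℝ) : EReal) else ⊤

/-- The perspective function of a real-valued `f`. -/
def perspective (f : H → ℝ) (x : H) (s : ℝ) : EReal :=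
  if 0 < s then ((s * f (s⁻¹ • x) : ℝ) : EReal)
  else if s = 0 then ⨆ y : H, ((f (y + x) - f y : ℝ) : EReal)
  else ⊤

/-- The metric projection onto `C` (a point of `C` nearest to `x`). -/
def projOn (C : Set H) (x : H) : H :=
  Classical.epsilon fun p => p ∈ C ∧ ∀ q ∈ C, ‖x - p‖ ≤ ‖x - q‖

/-- The closed convex hull. -/
def cloconv (C : Set H) : Set H := closure (convexHull ℝ C)

end Convex

/-! ### Signed measures and their averages -/

section Measures

variable {E₁ : Type*} [NormedAddCommGroup E₁] [InnerProductSpace ℝ E₁]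
  [MeasurableSpace E₁]

/-- The average `𝔈 m = ∫ v dm(v)` of a signed Borel measure on `S`. -/
def mean (S : Set E₁) (m : SignedMeasure S) : E₁ := ∫ᵛ v : S, (v : E₁) ∂<•m

/-- The functional `φ` on `C(S)` is integration against the signed measure `m`. -/
def Represents {S : Set E₁} (φ : StrongDual ℝ C(S, ℝ)) (m : SignedMeasure S) : Prop :=
  ∀ g : C(S, ℝ), φ g = ∫ᵛ v : S, g v ∂<•m

/-- On a compact set, `mean S m` is the unique vector `x` such that `⟪μ, x⟫ = ∫ ⟪μ, v⟫ dm(v)` for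
all `μ`. -/
theorem mean_unique [CompleteSpace E₁] [BorelSpace E₁] {S : Set E₁} (hS : IsCompact S)
    (m : SignedMeasure S) (x : E₁) :
    x = mean S m ↔ ∀ μ : E₁, ∫ᵛ v : S, ⟪μ, (v : E₁)⟫ ∂<•m = ⟪μ, x⟫ := by
  have : CompactSpace S := isCompact_iff_compactSpace.mp hS
  have hint : ∀ ν : Measure S, IsFiniteMeasure ν → Integrable (fun v : S => (v : E₁)) ν := by
    intro ν _
    exact continuous_subtype_val.integrable_of_hasCompactSupport
      (HasCompactSupport.of_compactSpace _)
  have key : ∀ μ : E₁, ∫ᵛ v : S, ⟪μ, (v : E₁)⟫ ∂<•m = ⟪μ, mean S m⟫ := by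
    intro μ
    set p := m.toJordanDecomposition.posPart
    set n := m.toJordanDecomposition.negPart
    have hm : m = p.toSignedMeasure - n.toSignedMeasure :=
      (SignedMeasure.toSignedMeasure_toJordanDecomposition m).symm
    have hp := hint p inferInstance
    have hn := hint n inferInstance
    have hp' : Integrable (fun v : S => ⟪μ, (v : E₁)⟫) p := hp.const_inner μ
    have hn' : Integrable (fun v : S => ⟪μ, (v : E₁)⟫) n := hn.const_inner μ
    have hv : ∀ (ν : Measure S) [IsFiniteMeasure ν], ν.toSignedMeasure.variation = ν := by
      intro ν _
      simp
    unfold mean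
    rw [hm, VectorMeasure.integral_sub_vectorMeasure, VectorMeasure.integral_sub_vectorMeasure,
      VectorMeasure.integral_toSignedMeasure, VectorMeasure.integral_toSignedMeasure,
      VectorMeasure.integral_toSignedMeasure, VectorMeasure.integral_toSignedMeasure,
      inner_sub_right, integral_inner hp, integral_inner hn]
    all_goals simpa only [VectorMeasure.Integrable, hv]
  constructor
  · rintro rfl
    exact key
  · intro h
    refine ext_inner_left ℝ fun μ => ?_
    rw [← h μ, key μ]

end Measures

/-! ### The problem and its standing assumptions -/

variable {E₁ E₂ : Type*} [NormedAddCommGroup E₁] [InnerProductSpace ℝ E₁] [CompleteSpace E₁]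
  [NormedAddCommGroup E₂] [InnerProductSpace ℝ E₂] [CompleteSpace E₂]

/-- The data of `minimize f x + σ_Q (A x - b) + ι_K x`, with `Q = Q₁ + Q₂`, and of the initial set
`Kinit` of cuts. -/
structure Problem (E₁ E₂ : Type*) [NormedAddCommGroup E₁] [InnerProductSpace ℝ E₁]
    [NormedAddCommGroup E₂] [InnerProductSpace ℝ E₂] where
  f : E₁ → ℝ
  Q₁ : Set E₂
  Q₂ : Set E₂
  K : Set E₁
  A : E₁ →L[ℝ] E₂
  b : E₂
  Kinit : Set E₁

namespace Problem

variable (P : Problem E₁ E₂)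

/-- The set `Q = Q₁ + Q₂`. -/
def Q : Set E₂ := P.Q₁ + P.Q₂

/-- The conjugate `f*`, the Hilbert space being identified with its dual. -/
def fstar (μ₁ : E₁) : EReal := fenchelConj (fun x => ((P.f x : ℝ) : EReal)) (innerSL ℝ μ₁)

/-- The linear functional `μ₁ + A* μ₂` given to the oracle. -/
def oracleDir (μ : WithLp 2 (E₁ × E₂)) : E₁ := μ.fst + ContinuousLinearMap.adjoint P.A μ.snd

/-- The set `{x | x₁ ∈ -S, x₂ = A x₁}`. -/
def graphNeg (S : Set E₁) : Set (WithLp 2 (E₁ × E₂)) := {x | -x.fst ∈ S ∧ x.snd = P.A x.fst}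

/-- The requirements on the starting point `μ⁰`. -/
def Admissible (μ : WithLp 2 (E₁ × E₂)) : Prop :=
  (subdiff P.fstar μ.fst).Nonempty ∧ μ.snd ∈ P.Q ∧
    P.oracleDir μ ∈ effDom (supportFn (-P.K))

/-- The standing assumptions, the last one being the qualification condition. -/
structure Standing : Prop where
  f_convex : ConvexOn ℝ Set.univ P.f
  f_differentiable : Differentiable ℝ P.f
  f_smooth : ∃ β : NNReal, 0 < β ∧ LipschitzWith β (gradient P.f)
  Q_nonempty : P.Q.Nonempty
  Q₁_closed : IsClosed P.Q₁
  Q₁_convex : Convex ℝ P.Q₁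
  Q₁_bounded : Bornology.IsBounded P.Q₁
  Q₂_closed : IsClosed P.Q₂
  Q₂_convex : Convex ℝ P.Q₂
  Q₂_cone : ∀ c : ℝ, 0 < c → ∀ q ∈ P.Q₂, c • q ∈ P.Q₂
  K_nonempty : P.K.Nonempty
  K_closed : IsClosed P.K
  K_convex : Convex ℝ P.K
  admissible : ∃ μ, P.Admissible μ
  Kinit_compact : IsCompact P.Kinit
  Kinit_subset : P.Kinit ⊆ P.K
  qualification : -P.b ∈ interior (polarCone P.Q₂ - P.A '' cloconv P.Kinit)

/-- A set is simple if it is the union of `Kinit` and of a finite set. -/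
def IsSimple (S : Set E₁) : Prop := ∃ J : Set E₁, J.Finite ∧ S = P.Kinit ∪ J

/-- The function `ψ(μ) = f*(μ₁) + ι_Q(μ₂) + ⟪μ₂, b⟫`. -/
def psi (μ : WithLp 2 (E₁ × E₂)) : EReal :=
  P.fstar μ.fst + ind P.Q μ.snd + ((⟪μ.snd, P.b⟫ : ℝ) : EReal)

/-! ### The projection problem

Below `μt`, `wt` are the current iterates `μᵗ`, `w₁ᵗ`, `S` is the current set of cuts `Kᵗ`, and `ℓ`
is the current level `ℓᵗ`. -/

/-- The level set `Qᵗ = {ψ + σ_{Eᵗ} ≤ ℓ}`, where `Eᵗ = {x | x₁ ∈ -S, x₂ = A x₁}`. -/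
def levelSet (S : Set E₁) (ℓ : ℝ) : Set (WithLp 2 (E₁ × E₂)) :=
  {μ | P.psi μ + supportFn (P.graphNeg S) μ ≤ (ℓ : EReal)}

/-- The objective of the Bregman projection problem; its feasible set is `levelSet`. -/
def projObj (μt : WithLp 2 (E₁ × E₂)) (wt : E₁) (μ : WithLp 2 (E₁ × E₂)) : EReal :=
  bregman P.fstar μ.fst μt.fst wt + ((1 / 2 * ‖μ.snd - μt.snd‖ ^ 2 : ℝ) : EReal)

/-- The constant by which the value of the projection problem is shifted. It equals
`f*(μ₁ᵗ) - ⟪μ₁ᵗ, wᵗ⟫ - ‖μ₂ᵗ‖² / 2`. -/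
def shift (μt : WithLp 2 (E₁ × E₂)) (wt : E₁) : ℝ := -P.f wt - 1 / 2 * ‖μt.snd‖ ^ 2

/-- The function `F` of the Fenchel–Rockafellar form of the projection problem, in the variables
`(μ, z)`, where `z` is a variable for an upper bound of `f*(μ₁)`. -/
def primalF (μt : WithLp 2 (E₁ × E₂)) (wt : E₁) (p : WithLp 2 (E₁ × E₂) × ℝ) : EReal :=
  ((p.2 - ⟪p.1.fst, wt⟫ + 1 / 2 * ‖p.1.snd‖ ^ 2 - ⟪p.1.snd, μt.snd⟫ : ℝ) : EReal)
    + ind {q : E₁ × ℝ | P.fstar q.1 ≤ (q.2 : EReal)} (p.1.fst, p.2)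
    + ind P.Q p.1.snd

/-- The operator `L` of the Fenchel–Rockafellar form of the projection problem:
`L (μ, z) = z + ⟪μ₂, b⟫ - ⟪μ₁ + A* μ₂, ·⟫`, a continuous function on `S`. -/
def primalL (S : Set E₁) : (WithLp 2 (E₁ × E₂) × ℝ) →L[ℝ] C(S, ℝ) where
  toFun p := ⟨fun v => p.2 + ⟪p.1.snd, P.b⟫ - ⟪P.oracleDir p.1, (v : E₁)⟫, by fun_prop⟩
  map_add' p q := by
    ext v
    simp [oracleDir, inner_add_left]
    ring
  map_smul' c p := by
    ext v
    simp [oracleDir, inner_add_left, inner_smul_left]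
    ring
  cont := by
    refine ContinuousMap.continuous_of_continuous_uncurry _ ?_
    have h1 : Continuous fun x : (WithLp 2 (E₁ × E₂) × ℝ) × S => x.1.1.fst :=
      (WithLp.fstL 2 ℝ E₁ E₂).continuous.comp (continuous_fst.comp continuous_fst)
    have h2 : Continuous fun x : (WithLp 2 (E₁ × E₂) × ℝ) × S => x.1.1.snd :=
      (WithLp.sndL 2 ℝ E₁ E₂).continuous.comp (continuous_fst.comp continuous_fst)
    simp only [Function.uncurry_def, oracleDir, ContinuousMap.coe_mk]
    fun_prop

section Expl

variable [MeasurableSpace E₁]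

/-- The point `μ̃₂ = -A 𝔈m + m(S) b + μ₂ᵗ`. -/
def muTilde (μt : WithLp 2 (E₁ × E₂)) (S : Set E₁) (m : SignedMeasure S) : E₂ :=
  -P.A (mean S m) + m Set.univ • P.b + μt.snd

/-- The objective of the explicit measure-valued problem; its feasible set is `{m | m ≤ 0}`. -/
def explObj (μt : WithLp 2 (E₁ × E₂)) (wt : E₁) (S : Set E₁) (ℓ : ℝ)
    (m : SignedMeasure S) : EReal :=
  perspective P.f (-mean S m + wt) (1 - m Set.univ)
    + ((1 / 2 * (‖P.muTilde μt S m‖ ^ 2 - Metric.infDist (P.muTilde μt S m) P.Q ^ 2)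
        - ℓ * m Set.univ : ℝ) : EReal)

/-- The update of `w₁`. -/
def nextW (wt : E₁) (S : Set E₁) (m : SignedMeasure S) : E₁ :=
  (1 - m Set.univ)⁻¹ • (wt - mean S m)

/-- The update of `μ`. -/
def nextMu (μt : WithLp 2 (E₁ × E₂)) (wt : E₁) (S : Set E₁) (m : SignedMeasure S) :
    WithLp 2 (E₁ × E₂) :=
  WithLp.toLp 2 (gradient P.f (nextW wt S m),
    projOn P.Q (μt.snd + m Set.univ • P.b - P.A (mean S m)))

end Expl

end Problem

/-- The function `G` of the Fenchel–Rockafellar form of the projection problem: the indicator of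
`{φ | φ - ℓ ∈ C(S; ℝ₋)}`. -/
def primalG (S : Set E₁) (ℓ : ℝ) : C(S, ℝ) → EReal := ind {φ | ∀ v, φ v - ℓ ≤ 0}

/-! ### The Dualized Level-Set algorithm -/

/-- The sequences generated by the algorithm. Here `Kprev t` is `K^{t-1}` and `gapRef t` is the
value of the reference gap at the beginning of iteration `t`. -/
structure Iterates (E₁ E₂ : Type*) [NormedAddCommGroup E₁] [InnerProductSpace ℝ E₁]
    [NormedAddCommGroup E₂] [InnerProductSpace ℝ E₂] [MeasurableSpace E₁] where
  μ : ℕ → WithLp 2 (E₁ × E₂)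
  w : ℕ → E₁
  v : ℕ → E₁
  xhat : ℕ → E₁
  hbar : ℕ → ℝ
  hlow : ℕ → ℝ
  gapRef : ℕ → EReal
  Kprev : ℕ → Set E₁
  m : ∀ t, SignedMeasure (Kprev (t + 1))

section Algorithm

variable [MeasurableSpace E₁]

/-- The set of cuts `Kᵗ`. -/
def Iterates.cuts (R : Iterates E₁ E₂) (t : ℕ) : Set E₁ := R.Kprev (t + 1)

/-- The primal-dual gap `Δᵗ`. -/
def Iterates.gap (R : Iterates E₁ E₂) (t : ℕ) : ℝ := R.hbar t - R.hlow t

/-- The level `ℓᵗ`. -/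
def Iterates.level (R : Iterates E₁ E₂) (lam : ℝ) (t : ℕ) : ℝ :=
  lam * R.hbar t + (1 - lam) * R.hlow t

/-- The set `K̃ᵗ`, the closed convex hull of `K^{t-1} ∪ {-v₁ᵗ}`. -/
def Iterates.hull (R : Iterates E₁ E₂) (t : ℕ) : Set E₁ := cloconv (R.Kprev t ∪ {-R.v t})

/-- The value of the dual cost at `μᵗ`, as it is computed in the algorithm. -/
def Iterates.dualValue (R : Iterates E₁ E₂) (P : Problem E₁ E₂) (t : ℕ) : ℝ :=
  ⟪(R.μ t).snd, P.b⟫ + ⟪(R.μ t).fst, R.w t⟫ + ⟪P.oracleDir (R.μ t), R.v t⟫ - P.f (R.w t)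

/-- `R` is a run of the Dualized Level-Set algorithm with parameter `lam` in which iteration `t` is
complete for all `t < T` and, if `T` is finite, iteration `T` is complete except for its last step
(the choice of the next dual candidate). For `T = ⊤` this is an infinite run. -/
structure IsRun (P : Problem E₁ E₂) (lam : ℝ) (R : Iterates E₁ E₂) (T : ℕ∞) : Prop where
  lam_pos : 0 < lam
  lam_lt_one : lam < 1
  init_μ : P.Admissible (R.μ 0)
  init_w : R.w 0 ∈ subdiff P.fstar (R.μ 0).fst
  init_gapRef : R.gapRef 0 = ⊤
  init_cuts : R.Kprev 0 = P.Kinit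
  /-- Oracle. -/
  oracle : ∀ t : ℕ, (t : ℕ∞) ≤ T → -R.v t ∈ P.K ∧
    ∀ x ∈ P.K, ⟪P.oracleDir (R.μ t), -R.v t⟫ ≤ ⟪P.oracleDir (R.μ t), x⟫
  /-- Dual update. -/
  hbar_zero : R.hbar 0 = R.dualValue P 0
  hbar_succ : ∀ t : ℕ, ((t + 1 : ℕ) : ℕ∞) ≤ T →
    R.hbar (t + 1) = min (R.hbar t) (R.dualValue P (t + 1))
  /-- Primal update. -/
  xhat_argmin : ∀ t : ℕ, (t : ℕ∞) ≤ T → R.xhat t ∈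
    argminOn (fun x => ((P.f x : ℝ) : EReal) + supportFn P.Q (P.A x - P.b)) (R.hull t)
  hlow_eq : ∀ t : ℕ, (t : ℕ∞) ≤ T → ((R.hlow t : ℝ) : EReal)
    = -((P.f (R.xhat t) : ℝ) : EReal) - supportFn P.Q (P.A (R.xhat t) - P.b)
  /-- Pruning. -/
  prune : ∀ t : ℕ, (t : ℕ∞) ≤ T →
    ((R.gap t : ℝ) : EReal) < ((1 - lam : ℝ) : EReal) * R.gapRef t →
    R.cuts t ⊆ R.hull t ∧ P.IsSimple (R.cuts t) ∧ R.xhat t ∈ cloconv (R.cuts t) ∧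
      R.gapRef (t + 1) = ((R.gap t : ℝ) : EReal)
  no_prune : ∀ t : ℕ, (t : ℕ∞) ≤ T →
    ¬ ((R.gap t : ℝ) : EReal) < ((1 - lam : ℝ) : EReal) * R.gapRef t →
    R.cuts t = R.Kprev t ∪ {-R.v t} ∧ R.gapRef (t + 1) = R.gapRef t
  /-- Dual candidate. -/
  candidate : ∀ t : ℕ, (t : ℕ∞) < T →
    R.m t ∈ argminOn (P.explObj (R.μ t) (R.w t) (R.cuts t) (R.level lam t)) {m | m ≤ 0}
  w_succ : ∀ t : ℕ, (t : ℕ∞) < T →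
    R.w (t + 1) = Problem.nextW (R.w t) (R.cuts t) (R.m t)
  μ_succ : ∀ t : ℕ, (t : ℕ∞) < T →
    R.μ (t + 1) = P.nextMu (R.μ t) (R.w t) (R.cuts t) (R.m t)

/-- The oracle assumption along a run: with `E = {x | x₁ ∈ -K, x₂ = A x₁}`, the subdifferential of
`σ_E` at each `μᵗ` is nonempty, and the vectors `vᵗ = (v₁ᵗ, A v₁ᵗ)` are uniformly bounded. -/
def OracleAssumption (P : Problem E₁ E₂) (R : Iterates E₁ E₂) (T : ℕ∞) : Prop :=
  (∀ t : ℕ, (t : ℕ∞) ≤ T → (subdiff (supportFn (P.graphNeg P.K)) (R.μ t)).Nonempty) ∧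
    ∃ C : ℝ, ∀ t : ℕ, (t : ℕ∞) ≤ T → ‖WithLp.toLp 2 (R.v t, P.A (R.v t))‖ ≤ C

end Algorithm

end DLS

end

open MeasureTheory DLS
open scoped RealInnerProductSpace

/-!
A solution of `(Mᵗ)` has the form `-ν` with `ν` a finite nonnegative measure on `S`, and the
objective of `(Mᵗ)` depends on `ν` only through its mean and its total mass. Let `p = (μ, z)` be the
point `(nextMu, f* (nextMu.fst))` computed from `ν`. The derivative of the objective at `ν` in the
direction of `ρ - ν` is `∫ (ℓ - L p) d(ρ - ν)`, so `ν` maximizes `ρ ↦ ∫ (L p - ℓ) dρ` among the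
nonnegative measures. Taking `ρ = ν + δ_v`, `0` and `2ν` gives `L p ≤ ℓ` on `S`, that is
`μ ∈ Qᵗ`, and `∫ (L p - ℓ) dν = 0`. Integrating against `ν` the constraint of any other point of
`Qᵗ` then gives the normal cone condition, which by the three-point identity of Bregman distances
yields optimality and uniqueness of `μ`.

The conjugate `F*` separates into the biconjugate of `f`, attained at a gradient, and the conjugate
of `‖·‖² / 2 + ι_Q`, attained at a projection; equality of the values of `(Mᵗ)` and `(Pᵗ)` follows
because `p` attains the supremum defining `F*`. Finally, `w₁ᵗ⁺¹` is a convex combination of `w₁ᵗ`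
and of an average of points of `Kᵗ`, so that the `w₁ᵗ` stay in any ball containing `w₁⁰` and all
cuts.
-/

namespace DLS

/-! ### Indicators, conjugates and minimizers -/

section ExtendedReal

variable {X : Type*}

lemma ind_of_mem {C : Set X} {x : X} (h : x ∈ C) : ind C x = 0 := if_pos h

lemma ind_of_notMem {C : Set X} {x : X} (h : x ∉ C) : ind C x = ⊤ := if_neg h

lemma ind_ne_bot (C : Set X) (x : X) : ind C x ≠ ⊥ := by
  unfold ind
  split_ifs <;> simp

lemma mem_of_ind_ne_top {C : Set X} {x : X} (h : ind C x ≠ ⊤) : x ∈ C :=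
  not_imp_comm.1 ind_of_notMem h

lemma iInf_eq_of_mem_argminOn {F : X → EReal} {C : Set X} {x : X} (h : x ∈ argminOn F C) :
    ⨅ y ∈ C, F y = F x :=
  le_antisymm (iInf₂_le x h.1) (le_iInf₂ fun _ hy => h.2 hy)

variable [AddCommGroup X] [Module ℝ X] [TopologicalSpace X]

lemma sub_le_fenchelConj (F : X → EReal) (φ : StrongDual ℝ X) (x : X) :
    ((φ x : ℝ) : EReal) - F x ≤ fenchelConj F φ :=
  le_iSup (fun y => ((φ y : ℝ) : EReal) - F y) x

lemma fenchelConj_ne_bot {F : X → EReal} {x : X} (hx : F x ≠ ⊤) (φ : StrongDual ℝ X) :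
    fenchelConj F φ ≠ ⊥ := by
  refine ne_bot_of_le_ne_bot ?_ (sub_le_fenchelConj F φ x)
  rw [sub_eq_add_neg, ne_eq, EReal.add_eq_bot_iff]
  simp [hx]

end ExtendedReal

/-! ### Signed measures -/

section SignedMeasure

variable {X : Type*} [MeasurableSpace X]

lemma neg_toSignedMeasure_nonpos (ν : Measure X) [IsFiniteMeasure ν] : -ν.toSignedMeasure ≤ 0 :=
  neg_nonpos.2 ν.zero_le_toSignedMeasure

lemma exists_eq_neg_toSignedMeasure {m : SignedMeasure X} (hm : m ≤ 0) :
    ∃ ν : Measure X, ∃ _ : IsFiniteMeasure ν, m = -ν.toSignedMeasure := by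
  have hm' : m ≤[Set.univ] 0 := (VectorMeasure.le_restrict_univ_iff_le _ _).2 hm
  refine ⟨m.toMeasureOfLEZero Set.univ .univ hm', inferInstance, ?_⟩
  rw [SignedMeasure.toMeasureOfLEZero_toSignedMeasure m hm', neg_neg]

lemma neg_toSignedMeasure_univ (ν : Measure X) [IsFiniteMeasure ν] :
    (-ν.toSignedMeasure) Set.univ = -ν.real Set.univ := by
  simp [Measure.toSignedMeasure_apply_measurable MeasurableSet.univ]

lemma integral_neg_toSignedMeasure {G : Type*} [NormedAddCommGroup G] [NormedSpace ℝ G]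
    (ν : Measure X) [IsFiniteMeasure ν] (g : X → G) :
    ∫ᵛ v, g v ∂<•(-ν.toSignedMeasure) = -∫ v, g v ∂ν := by
  rw [VectorMeasure.integral_neg_vectorMeasure, VectorMeasure.integral_toSignedMeasure]

end SignedMeasure

section CompactSpace

variable {X : Type*} [TopologicalSpace X] [CompactSpace X] [MeasurableSpace X]

lemma exists_measure_of_nonneg [BorelSpace X] [T2Space X] (φ : StrongDual ℝ C(X, ℝ))
    (hφ : ∀ g : C(X, ℝ), (∀ v, 0 ≤ g v) → 0 ≤ φ g) :
    ∃ ν : Measure X, ∃ _ : IsFiniteMeasure ν, ∀ g : C(X, ℝ), φ g = ∫ v, g v ∂ν := by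
  let Λ : CompactlySupportedContinuousMap X ℝ →ₚ[ℝ] ℝ := PositiveLinearMap.mk₀
    { toFun := fun g => φ g.toContinuousMap
      map_add' := fun g h => map_add φ g.toContinuousMap h.toContinuousMap
      map_smul' := fun c g => map_smul φ c g.toContinuousMap }
    (fun g hg => hφ _ hg)
  refine ⟨RealRMK.rieszMeasure Λ, inferInstance, fun g => ?_⟩
  exact (RealRMK.integral_rieszMeasure Λ
    (CompactlySupportedContinuousMap.continuousMapEquiv g)).symm

variable [OpensMeasurableSpace X]

lemma integrable_continuousMap (g : C(X, ℝ)) (ν : Measure X) [IsFiniteMeasure ν] :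
    Integrable (fun v => g v) ν :=
  g.continuous.integrable_of_hasCompactSupport (HasCompactSupport.of_compactSpace _)

lemma integral_signedMeasure_eq_sub (m : SignedMeasure X) (g : C(X, ℝ)) :
    ∫ᵛ v, g v ∂<•m = ∫ v, g v ∂m.toJordanDecomposition.posPart
      - ∫ v, g v ∂m.toJordanDecomposition.negPart := by
  conv_lhs => rw [← m.toSignedMeasure_toJordanDecomposition, JordanDecomposition.toSignedMeasure]
  rw [VectorMeasure.integral_sub_vectorMeasure, VectorMeasure.integral_toSignedMeasure,
    VectorMeasure.integral_toSignedMeasure]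
  all_goals
    simpa only [VectorMeasure.Integrable, Measure.variation_toSignedMeasure]
      using integrable_continuousMap g _

/-- Integration of continuous functions against a finite measure, as a continuous linear
functional. -/
noncomputable def integralDual (ν : Measure X) [IsFiniteMeasure ν] : StrongDual ℝ C(X, ℝ) :=
  LinearMap.mkContinuous
    { toFun := fun g => ∫ v, g v ∂ν
      map_add' := fun g h =>
        integral_add (integrable_continuousMap g ν) (integrable_continuousMap h ν)
      map_smul' := fun c g => integral_const_mul c g }
    (ν.real Set.univ) fun g => by
      rw [mul_comm]
      exact norm_integral_le_of_norm_le_const (.of_forall g.norm_coe_le_norm)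

lemma eq_of_forall_integral_continuousMap_eq [BorelSpace X] [HasOuterApproxClosed X]
    {m₁ m₂ : SignedMeasure X}
    (h : ∀ g : C(X, ℝ), ∫ᵛ v, g v ∂<•m₁ = ∫ᵛ v, g v ∂<•m₂) : m₁ = m₂ := by
  set p₁ := m₁.toJordanDecomposition.posPart
  set n₁ := m₁.toJordanDecomposition.negPart
  set p₂ := m₂.toJordanDecomposition.posPart
  set n₂ := m₂.toJordanDecomposition.negPart
  have hadd : p₁ + n₂ = p₂ + n₁ := by
    refine ext_of_forall_integral_eq_of_IsFiniteMeasure fun g => ?_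
    have hi (ν : Measure X) [IsFiniteMeasure ν] : Integrable (fun v => g v) ν :=
      integrable_continuousMap g.toContinuousMap ν
    have hg := h g.toContinuousMap
    simp only [integral_signedMeasure_eq_sub] at hg
    rw [integral_add_measure (hi p₁) (hi n₂), integral_add_measure (hi p₂) (hi n₁)]
    exact sub_eq_sub_iff_add_eq_add.1 hg
  rw [← m₁.toSignedMeasure_toJordanDecomposition, ← m₂.toSignedMeasure_toJordanDecomposition,
    JordanDecomposition.toSignedMeasure, JordanDecomposition.toSignedMeasure,
    sub_eq_sub_iff_add_eq_add, ← Measure.toSignedMeasure_add, ← Measure.toSignedMeasure_add]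
  congr 1

section Maximizer

variable {ν : Measure X} [IsFiniteMeasure ν] {g : C(X, ℝ)}
  (hmax : ∀ (ρ : Measure X) [IsFiniteMeasure ρ], ∫ v, g v ∂ρ ≤ ∫ v, g v ∂ν)

include hmax

lemma nonpos_of_forall_integral_le (v : X) : g v ≤ 0 := by
  have h := hmax (ν + Measure.dirac v)
  rw [integral_add_measure (integrable_continuousMap g ν) (integrable_continuousMap g _),
    integral_dirac' _ _ g.continuous.stronglyMeasurable] at h
  linarith

lemma integral_eq_zero_of_forall_integral_le : ∫ v, g v ∂ν = 0 := by
  have hzero := hmax 0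
  have htwice := hmax (ν + ν)
  have hint := integrable_continuousMap g ν
  rw [integral_zero_measure] at hzero
  rw [integral_add_measure hint hint] at htwice
  linarith

end Maximizer

end CompactSpace

section Representation

variable {E₁ : Type*} [NormedAddCommGroup E₁] [MeasurableSpace E₁] {S : Set E₁}

lemma mean_neg_toSignedMeasure [InnerProductSpace ℝ E₁] (ν : Measure S) [IsFiniteMeasure ν] :
    mean S (-ν.toSignedMeasure) = -∫ v, (v : E₁) ∂ν :=
  integral_neg_toSignedMeasure ν _

variable [BorelSpace E₁]

lemma integrable_coe (hS : IsCompact S) (ν : Measure S) [IsFiniteMeasure ν] :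
    Integrable (fun v : S => (v : E₁)) ν := by
  have : CompactSpace S := isCompact_iff_compactSpace.mp hS
  exact continuous_subtype_val.integrable_of_hasCompactSupport
    (HasCompactSupport.of_compactSpace _)

lemma exists_represents (hS : IsCompact S) (m : SignedMeasure S) :
    ∃ φ : StrongDual ℝ C(S, ℝ), Represents φ m := by
  have : CompactSpace S := isCompact_iff_compactSpace.mp hS
  exact ⟨integralDual m.toJordanDecomposition.posPart
    - integralDual m.toJordanDecomposition.negPart,
    fun g => (integral_signedMeasure_eq_sub m g).symm⟩

lemma represents_unique (hS : IsCompact S) {φ : StrongDual ℝ C(S, ℝ)} {m₁ m₂ : SignedMeasure S}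
    (h₁ : Represents φ m₁) (h₂ : Represents φ m₂) : m₁ = m₂ := by
  have : CompactSpace S := isCompact_iff_compactSpace.mp hS
  exact eq_of_forall_integral_continuousMap_eq fun g => (h₁ g).symm.trans (h₂ g)

lemma exists_represents_of_nonpos (hS : IsCompact S) {φ : StrongDual ℝ C(S, ℝ)}
    (hφ : ∀ g : C(S, ℝ), (∀ v, 0 ≤ g v) → φ g ≤ 0) :
    ∃ m : SignedMeasure S, m ≤ 0 ∧ Represents φ m := by
  have : CompactSpace S := isCompact_iff_compactSpace.mp hS
  obtain ⟨ν, _, hν⟩ := exists_measure_of_nonneg (-φ) fun g hg => neg_nonneg.2 (hφ g hg)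
  refine ⟨-ν.toSignedMeasure, neg_toSignedMeasure_nonpos ν, fun g => ?_⟩
  rw [integral_neg_toSignedMeasure, ← hν, neg_apply, neg_neg]

end Representation

/-! ### Metric projections -/

section Projection

variable {H : Type*} [NormedAddCommGroup H] {C : Set H}

/-- The function `(‖·‖² - dist(·, C)²) / 2`, a potential of the metric projection onto a closed
convex set `C`. It is the conjugate of `‖·‖² / 2 + ι_C`. -/
noncomputable def projPotential (C : Set H) (y : H) : ℝ :=
  1 / 2 * (‖y‖ ^ 2 - Metric.infDist y C ^ 2)

variable [InnerProductSpace ℝ H]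

lemma inner_sub_half_norm_sq_le_projPotential (y : H) {q : H} (hq : q ∈ C) :
    ⟪q, y⟫ - 1 / 2 * ‖q‖ ^ 2 ≤ projPotential C y := by
  have hdist : Metric.infDist y C ^ 2 ≤ ‖y - q‖ ^ 2 := by
    rw [← dist_eq_norm]
    exact pow_le_pow_left₀ Metric.infDist_nonneg (Metric.infDist_le_dist_of_mem hq) 2
  rw [norm_sub_sq_real, real_inner_comm] at hdist
  rw [projPotential]
  linarith

variable [CompleteSpace H] (hne : C.Nonempty) (hcl : IsClosed C) (hco : Convex ℝ C)

include hne hcl hco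

lemma projOn_spec (x : H) : projOn C x ∈ C ∧ ∀ q ∈ C, ‖x - projOn C x‖ ≤ ‖x - q‖ := by
  obtain ⟨p, hp, hpx⟩ := exists_norm_eq_iInf_of_complete_convex hne hcl.isComplete hco x
  refine Classical.epsilon_spec (p := fun p => p ∈ C ∧ ∀ q ∈ C, ‖x - p‖ ≤ ‖x - q‖)
    ⟨p, hp, fun q hq => hpx.trans_le ?_⟩
  exact ciInf_le ⟨0, by rintro _ ⟨w, rfl⟩; exact norm_nonneg _⟩ (⟨q, hq⟩ : C)

lemma projOn_mem (x : H) : projOn C x ∈ C := (projOn_spec hne hcl hco x).1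

lemma inner_sub_projOn_nonpos (x : H) {q : H} (hq : q ∈ C) :
    ⟪x - projOn C x, q - projOn C x⟫ ≤ 0 := by
  obtain ⟨hp, hmin⟩ := projOn_spec hne hcl hco x
  have : Nonempty C := hne.to_subtype
  have hbdd : BddBelow (Set.range fun w : C => ‖x - w‖) :=
    ⟨0, by rintro _ ⟨w, rfl⟩; exact norm_nonneg _⟩
  exact (norm_eq_iInf_iff_real_inner_le_zero hco hp).1
    (le_antisymm (le_ciInf fun w => hmin w w.2) (ciInf_le hbdd ⟨projOn C x, hp⟩)) q hq

lemma norm_sub_projOn_sq_le (x : H) {q : H} (hq : q ∈ C) :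
    ‖q - projOn C x‖ ^ 2 ≤ ‖x - q‖ ^ 2 - ‖x - projOn C x‖ ^ 2 := by
  have hvar := inner_sub_projOn_nonpos hne hcl hco x hq
  have hexp := norm_sub_sq_real (x - projOn C x) (q - projOn C x)
  rw [sub_sub_sub_cancel_right] at hexp
  linarith

lemma infDist_eq_norm_sub_projOn (x : H) : Metric.infDist x C = ‖x - projOn C x‖ := by
  obtain ⟨hp, hmin⟩ := projOn_spec hne hcl hco x
  rw [← dist_eq_norm]
  refine le_antisymm (Metric.infDist_le_dist_of_mem hp) ((Metric.le_infDist hne).2 fun q hq => ?_)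
  simpa only [dist_eq_norm] using hmin q hq

lemma projPotential_eq_inner_projOn (y : H) :
    projPotential C y = ⟪projOn C y, y⟫ - 1 / 2 * ‖projOn C y‖ ^ 2 := by
  rw [projPotential, infDist_eq_norm_sub_projOn hne hcl hco, norm_sub_sq_real, real_inner_comm]
  ring

lemma inner_sub_half_norm_sq_add_le_projPotential (y : H) {q : H} (hq : q ∈ C) :
    ⟪q, y⟫ - 1 / 2 * ‖q‖ ^ 2 + 1 / 2 * ‖q - projOn C y‖ ^ 2 ≤ projPotential C y := by
  have hpyth := norm_sub_projOn_sq_le hne hcl hco y hq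
  have hexp := norm_sub_sq_real y q
  rw [real_inner_comm] at hexp
  rw [projPotential, infDist_eq_norm_sub_projOn hne hcl hco]
  linarith

lemma hasGradientAt_projPotential (y : H) :
    HasGradientAt (projPotential C) (projOn C y) y := by
  rw [hasGradientAt_iff_isLittleO_nhds_zero]
  refine (Asymptotics.IsBigO.of_bound (1 / 2) (.of_forall fun h => ?_)).trans_isLittleO
    (Asymptotics.isLittleO_norm_pow_id one_lt_two)
  set p := projOn C y
  set q := projOn C (y + h)
  have hvalue : projPotential C y = ⟪p, y⟫ - 1 / 2 * ‖p‖ ^ 2 :=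
    projPotential_eq_inner_projOn hne hcl hco y
  have hvalue_add : projPotential C (y + h) = ⟪q, y + h⟫ - 1 / 2 * ‖q‖ ^ 2 :=
    projPotential_eq_inner_projOn hne hcl hco (y + h)
  have hlower : ⟪p, y + h⟫ - 1 / 2 * ‖p‖ ^ 2 ≤ projPotential C (y + h) :=
    inner_sub_half_norm_sq_le_projPotential _ (projOn_mem hne hcl hco y)
  have hupper : ⟪q, y⟫ - 1 / 2 * ‖q‖ ^ 2 + 1 / 2 * ‖q - p‖ ^ 2 ≤ projPotential C y :=
    inner_sub_half_norm_sq_add_le_projPotential hne hcl hco y (projOn_mem hne hcl hco _)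
  have hsq : ‖(q - p) - h‖ ^ 2 = ‖q - p‖ ^ 2 - 2 * (⟪q, h⟫ - ⟪p, h⟫) + ‖h‖ ^ 2 := by
    rw [norm_sub_sq_real, inner_sub_left]
  rw [inner_add_right] at hvalue_add hlower
  rw [Real.norm_of_nonneg (by linarith), Real.norm_of_nonneg (by positivity)]
  linarith [sq_nonneg ‖(q - p) - h‖]

end Projection

/-! ### Sums of closed convex sets -/

section ClosedSum

variable {H : Type*} [NormedAddCommGroup H] [InnerProductSpace ℝ H] [CompleteSpace H]

-- The projections of `0` onto the sets converge: their norms increase to a limit and, by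
-- `norm_sub_projOn_sq_le`, control their distances.
lemma nonempty_iInter_of_antitone_of_convex {C : ℕ → Set H} (hanti : Antitone C)
    (hne : ∀ n, (C n).Nonempty) (hcl : ∀ n, IsClosed (C n)) (hco : ∀ n, Convex ℝ (C n))
    (hb : Bornology.IsBounded (C 0)) : (⋂ n, C n).Nonempty := by
  set x : ℕ → H := fun n => projOn (C n) 0
  have hmem {n k : ℕ} (hnk : n ≤ k) : x k ∈ C n :=
    hanti hnk (projOn_mem (hne k) (hcl k) (hco k) 0)
  have hdist {n k : ℕ} (hnk : n ≤ k) : ‖x k - x n‖ ^ 2 ≤ ‖x k‖ ^ 2 - ‖x n‖ ^ 2 := by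
    simpa only [zero_sub, norm_neg] using
      norm_sub_projOn_sq_le (hne n) (hcl n) (hco n) 0 (hmem hnk)
  have hmono : Monotone fun n => ‖x n‖ ^ 2 := fun n k hnk => by
    linarith [hdist hnk, sq_nonneg ‖x k - x n‖]
  obtain ⟨B, hB⟩ := hb.exists_norm_le
  have hbdd : BddAbove (Set.range fun n => ‖x n‖ ^ 2) :=
    ⟨B ^ 2, by rintro _ ⟨n, rfl⟩; exact pow_le_pow_left₀ (norm_nonneg _) (hB _ (hmem n.zero_le)) 2⟩
  set L := ⨆ n, ‖x n‖ ^ 2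
  have hlim : Filter.Tendsto (fun n => √(L - ‖x n‖ ^ 2)) Filter.atTop (nhds 0) := by
    have hnorm : Filter.Tendsto (fun n => ‖x n‖ ^ 2) Filter.atTop (nhds L) :=
      tendsto_atTop_ciSup hmono hbdd
    simpa only [sub_self, Real.sqrt_zero] using (hnorm.const_sub L).sqrt
  have hcauchy : CauchySeq x := by
    refine cauchySeq_of_le_tendsto_0' _ (fun n k hnk => ?_) hlim
    rw [dist_comm, dist_eq_norm]
    exact Real.le_sqrt_of_sq_le ((hdist hnk).trans (sub_le_sub_right (le_ciSup hbdd k) _))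
  obtain ⟨y, hy⟩ := cauchySeq_tendsto_of_complete hcauchy
  refine ⟨y, Set.mem_iInter.2 fun n => (hcl n).mem_of_tendsto hy ?_⟩
  filter_upwards [Filter.eventually_ge_atTop n] with k hk using hmem hk

lemma isClosed_add_of_isBounded {C D : Set H} (hC : IsClosed C) (hCc : Convex ℝ C)
    (hCb : Bornology.IsBounded C) (hD : IsClosed D) (hDc : Convex ℝ D) : IsClosed (C + D) := by
  refine isClosed_of_closure_subset fun y hy => ?_
  obtain ⟨δ, hδanti, hδpos, hδ⟩ := exists_seq_strictAnti_tendsto (0 : ℝ)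
  let U : ℕ → Set H := fun n => C ∩ (fun x => y - x) ⁻¹' Metric.cthickening (δ n) D
  have hUne (n : ℕ) : (U n).Nonempty := by
    obtain ⟨_, hz, hyz⟩ := Metric.mem_closure_iff.1 hy (δ n) (hδpos n)
    obtain ⟨c, hc, d, hd, rfl⟩ := Set.mem_add.1 hz
    refine ⟨c, hc, Metric.mem_cthickening_of_dist_le _ d _ _ hd ?_⟩
    rw [dist_eq_norm] at hyz ⊢
    rw [sub_sub]
    exact hyz.le
  have hUco (n : ℕ) : Convex ℝ (U n) :=
    hCc.inter ((hDc.cthickening (δ n)).affine_preimage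
      (AffineMap.const ℝ H y - AffineMap.id ℝ H))
  have hUanti : Antitone U := fun n k hnk =>
    Set.inter_subset_inter_right _
      (Set.preimage_mono (Metric.cthickening_mono (hδanti.antitone hnk) _))
  obtain ⟨x, hx⟩ := nonempty_iInter_of_antitone_of_convex hUanti hUne
    (fun n => hC.inter (Metric.isClosed_cthickening.preimage (by fun_prop))) hUco
    (hCb.subset Set.inter_subset_left)
  have hxU : ∀ n, x ∈ U n := Set.mem_iInter.1 hx
  refine Set.mem_add.2 ⟨x, (hxU 0).1, y - x, ?_, by abel⟩
  rw [← hD.closure_eq, Metric.closure_eq_iInter_cthickening' D (Set.range δ)]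
  · refine Set.mem_iInter₂.2 ?_
    rintro _ ⟨n, rfl⟩
    exact (hxU n).2
  · intro ε hε
    obtain ⟨n, hn⟩ := (hδ.eventually (gt_mem_nhds hε)).exists
    exact ⟨δ n, ⟨n, rfl⟩, hδpos n, hn.le⟩

end ClosedSum

/-! ### Gradients and conjugates of convex functions -/

section Gradient

variable {H : Type*} [NormedAddCommGroup H] [InnerProductSpace ℝ H] [CompleteSpace H]
  {f : H → ℝ}

lemma hasDerivAt_comp_of_hasGradientAt {c : ℝ → H} {g c' : H} {s : ℝ}
    (hf : HasGradientAt f g (c s)) (hc : HasDerivAt c c' s) :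
    HasDerivAt (fun t => f (c t)) ⟪g, c'⟫ s := by
  simpa only [Function.comp_def, InnerProductSpace.toDual_apply_apply] using
    hf.hasFDerivAt.comp_hasDerivAt s hc

lemma add_inner_gradient_le_of_convexOn (hf : ConvexOn ℝ Set.univ f) {x : H}
    (hd : DifferentiableAt ℝ f x) (y : H) : f x + ⟪gradient f x, y - x⟫ ≤ f y := by
  have hderiv : HasDerivAt (fun t : ℝ => f (AffineMap.lineMap x y t)) ⟪gradient f x, y - x⟫ 0 :=
    hasDerivAt_comp_of_hasGradientAt (by simpa using hd.hasGradientAt) AffineMap.hasDerivAt_lineMap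
  have hconv : ConvexOn ℝ Set.univ (fun t : ℝ => f (AffineMap.lineMap x y t)) :=
    hf.comp_affineMap (AffineMap.lineMap x y)
  have hslope := hconv.le_slope_of_hasDerivAt (Set.mem_univ 0) (Set.mem_univ 1) zero_lt_one hderiv
  rw [slope_def_field, AffineMap.lineMap_apply_one, AffineMap.lineMap_apply_zero, sub_zero,
    div_one] at hslope
  linarith

lemma eq_gradient_of_forall_add_inner_le {x g : H} (hd : DifferentiableAt ℝ f x)
    (h : ∀ y, f x + ⟪g, y - x⟫ ≤ f y) : g = gradient f x := by
  have hmin : IsLocalMin (fun y => f y - ⟪g, y⟫) x := by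
    refine .of_forall fun y => ?_
    have hy := h y
    rw [inner_sub_right] at hy
    linarith
  have hzero := hmin.hasFDerivAt_eq_zero
    (hd.hasGradientAt.hasFDerivAt.sub (innerSL ℝ g).hasFDerivAt)
  refine (InnerProductSpace.toDual ℝ H).injective ?_
  exact (sub_eq_zero.1 hzero).symm

end Gradient

section HilbertConj

variable {H : Type*} [NormedAddCommGroup H] [InnerProductSpace ℝ H]

/-- The Legendre–Fenchel conjugate of a real-valued function on a Hilbert space identified with its
dual. -/
noncomputable def hilbertConj (f : H → ℝ) (μ : H) : EReal :=
  fenchelConj (fun x => (f x : EReal)) (innerSL ℝ μ)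

variable {f : H → ℝ}

lemma inner_sub_le_hilbertConj (μ x : H) : ((⟪μ, x⟫ - f x : ℝ) : EReal) ≤ hilbertConj f μ :=
  sub_le_fenchelConj (fun x => (f x : EReal)) (innerSL ℝ μ) x

lemma inner_sub_le_of_hilbertConj_le {μ : H} {z : ℝ} (h : hilbertConj f μ ≤ z) (x : H) :
    ⟪μ, x⟫ - f x ≤ z :=
  EReal.coe_le_coe_iff.1 ((inner_sub_le_hilbertConj μ x).trans h)

lemma hilbertConj_ne_bot (μ : H) : hilbertConj f μ ≠ ⊥ :=
  fenchelConj_ne_bot (F := fun x => (f x : EReal)) (EReal.coe_ne_top (f 0)) _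

lemma exists_hilbertConj_eq_coe {μ : H} (h : hilbertConj f μ ≠ ⊤) :
    ∃ r : ℝ, hilbertConj f μ = r :=
  ⟨_, (EReal.coe_toReal h (hilbertConj_ne_bot μ)).symm⟩

variable [CompleteSpace H] {μ μ' w : H}

lemma eq_gradient_of_hilbertConj_le (hd : DifferentiableAt ℝ f w)
    (h : hilbertConj f μ ≤ ((⟪μ, w⟫ - f w : ℝ) : EReal)) : μ = gradient f w := by
  refine eq_gradient_of_forall_add_inner_le hd fun y => ?_
  have hy := inner_sub_le_of_hilbertConj_le h y
  rw [inner_sub_right]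
  linarith

variable (hc : ConvexOn ℝ Set.univ f) (hd : DifferentiableAt ℝ f w)

include hc hd

lemma hilbertConj_gradient :
    hilbertConj f (gradient f w) = ((⟪gradient f w, w⟫ - f w : ℝ) : EReal) := by
  refine le_antisymm (iSup_le fun y => ?_) (inner_sub_le_hilbertConj _ w)
  rw [← EReal.coe_sub, EReal.coe_le_coe_iff, innerSL_apply_apply]
  have htangent := add_inner_gradient_le_of_convexOn hc hd y
  rw [inner_sub_right] at htangent
  linarith

lemma mem_subdiff_hilbertConj_iff : w ∈ subdiff (hilbertConj f) μ ↔ μ = gradient f w := by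
  constructor
  · intro h
    have hgrad := h (gradient f w)
    rw [hilbertConj_gradient hc hd] at hgrad
    have hfinite : hilbertConj f μ ≠ ⊤ := by
      intro htop
      rw [htop, EReal.top_add_coe] at hgrad
      exact EReal.coe_ne_top _ (top_le_iff.1 hgrad)
    obtain ⟨r, hr⟩ := exists_hilbertConj_eq_coe hfinite
    refine eq_gradient_of_hilbertConj_le hd ?_
    rw [hr, ← EReal.coe_add, EReal.coe_le_coe_iff, inner_sub_right, real_inner_comm,
      real_inner_comm μ] at hgrad
    rw [hr, EReal.coe_le_coe_iff]
    linarith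
  · rintro rfl y
    rw [hilbertConj_gradient hc hd, ← EReal.coe_add]
    refine le_trans (EReal.coe_le_coe_iff.2 (le_of_eq ?_)) (inner_sub_le_hilbertConj y w)
    rw [inner_sub_right, real_inner_comm w, real_inner_comm w]
    ring

lemma hilbertConj_of_mem_subdiff (h : w ∈ subdiff (hilbertConj f) μ) :
    hilbertConj f μ = ((⟪μ, w⟫ - f w : ℝ) : EReal) := by
  rw [(mem_subdiff_hilbertConj_iff hc hd).1 h, hilbertConj_gradient hc hd]

lemma bregman_hilbertConj (h : w ∈ subdiff (hilbertConj f) μ') :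
    bregman (hilbertConj f) μ μ' w = hilbertConj f μ + ((f w - ⟪μ, w⟫ : ℝ) : EReal) := by
  rw [bregman, if_pos h, hilbertConj_of_mem_subdiff hc hd h, sub_eq_add_neg, sub_eq_add_neg,
    ← EReal.coe_neg, ← EReal.coe_neg, add_assoc, ← EReal.coe_add, inner_sub_left]
  congr 2
  ring

end HilbertConj

/-! ### The objective of the projection problem -/

section ProjObj

variable {E₁ E₂ : Type*} [NormedAddCommGroup E₁] [InnerProductSpace ℝ E₁]
  [NormedAddCommGroup E₂] [InnerProductSpace ℝ E₂] {P : Problem E₁ E₂}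

lemma Problem.fstar_eq_hilbertConj : P.fstar = hilbertConj P.f := rfl

variable [CompleteSpace E₁] {μt μ μ' : WithLp 2 (E₁ × E₂)} {wt w' : E₁}
  (hc : ConvexOn ℝ Set.univ P.f) (hd : Differentiable ℝ P.f) (hw : wt ∈ subdiff P.fstar μt.fst)

include hc hd hw

lemma Problem.projObj_eq_fstar_add : P.projObj μt wt μ = P.fstar μ.fst
    + ((P.f wt - ⟪μ.fst, wt⟫ + 1 / 2 * ‖μ.snd - μt.snd‖ ^ 2 : ℝ) : EReal) := by
  rw [projObj, fstar_eq_hilbertConj, bregman_hilbertConj hc (hd wt) hw, add_assoc,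
    ← EReal.coe_add]

lemma Problem.projObj_nonneg : 0 ≤ P.projObj μt wt μ := by
  have hFY : ((⟪μ.fst, wt⟫ - P.f wt : ℝ) : EReal) ≤ P.fstar μ.fst :=
    inner_sub_le_hilbertConj μ.fst wt
  rw [projObj_eq_fstar_add hc hd hw]
  refine le_trans ?_ (add_le_add_left hFY _)
  rw [← EReal.coe_add, EReal.coe_nonneg]
  linarith [sq_nonneg ‖μ.snd - μt.snd‖]

lemma Problem.eq_of_projObj_nonpos (h : P.projObj μt wt μ ≤ 0) : μ = μt := by
  rw [projObj_eq_fstar_add hc hd hw] at h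
  obtain ⟨r, hr⟩ : ∃ r : ℝ, P.fstar μ.fst = r := by
    refine exists_hilbertConj_eq_coe fun htop => ?_
    rw [fstar_eq_hilbertConj, htop, EReal.top_add_coe] at h
    exact EReal.zero_lt_top.not_ge h
  have hFY : ⟪μ.fst, wt⟫ - P.f wt ≤ r := inner_sub_le_of_hilbertConj_le hr.le wt
  rw [hr, ← EReal.coe_add, EReal.coe_nonpos] at h
  have hfst : μ.fst = μt.fst := by
    rw [(mem_subdiff_hilbertConj_iff hc (hd wt)).1 hw]
    refine eq_gradient_of_hilbertConj_le (hd wt) (hr.le.trans (EReal.coe_le_coe_iff.2 ?_))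
    linarith [sq_nonneg ‖μ.snd - μt.snd‖]
  have hsnd : ‖μ.snd - μt.snd‖ ^ 2 = 0 :=
    le_antisymm (by linarith) (sq_nonneg _)
  exact WithLp.ofLp_injective 2
    (Prod.ext hfst (sub_eq_zero.1 (norm_eq_zero.1 (sq_eq_zero_iff.1 hsnd))))

lemma Problem.projObj_three_point (hw' : w' ∈ subdiff P.fstar μ'.fst) :
    P.projObj μt wt μ
        + ((⟪WithLp.toLp 2 (wt - w', μt.snd - μ'.snd), μ - μ'⟫ : ℝ) : EReal)
      = P.projObj μt wt μ' + P.projObj μ' w' μ := by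
  have hμ' : P.fstar μ'.fst = ((⟪μ'.fst, w'⟫ - P.f w' : ℝ) : EReal) :=
    hilbertConj_of_mem_subdiff hc (hd w') hw'
  rw [projObj_eq_fstar_add hc hd hw, projObj_eq_fstar_add hc hd hw,
    projObj_eq_fstar_add hc hd hw', hμ', ← EReal.coe_add, add_left_comm, add_assoc,
    ← EReal.coe_add, ← EReal.coe_add, WithLp.prod_inner_apply]
  have hpoly : ‖μ.snd - μt.snd‖ ^ 2 = ‖μ.snd - μ'.snd‖ ^ 2
      + 2 * ⟪μ.snd - μ'.snd, μ'.snd - μt.snd⟫ + ‖μ'.snd - μt.snd‖ ^ 2 := by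
    rw [← norm_add_sq_real, sub_add_sub_cancel]
  have hfst : ⟪wt - w', μ.fst - μ'.fst⟫
      = ⟪μ.fst, wt⟫ - ⟪μ'.fst, wt⟫ - ⟪μ.fst, w'⟫ + ⟪μ'.fst, w'⟫ := by
    simp only [inner_sub_left, inner_sub_right, real_inner_comm wt, real_inner_comm w']
    ring
  have hsnd : ⟪μt.snd - μ'.snd, μ.snd - μ'.snd⟫ = -⟪μ.snd - μ'.snd, μ'.snd - μt.snd⟫ := by
    rw [← inner_neg_right, neg_sub, real_inner_comm]
  congr 2
  change _ + (⟪wt - w', μ.fst - μ'.fst⟫ + ⟪μt.snd - μ'.snd, μ.snd - μ'.snd⟫) = _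
  rw [hfst, hsnd, hpoly]
  ring

lemma Problem.argminOn_projObj_of_mem_normalCone {C : Set (WithLp 2 (E₁ × E₂))}
    (hw' : w' ∈ subdiff P.fstar μ'.fst)
    (hN : WithLp.toLp 2 (wt - w', μt.snd - μ'.snd) ∈ normalCone C μ') :
    argminOn (P.projObj μt wt) C = {μ'} := by
  have hgrowth {μ : WithLp 2 (E₁ × E₂)} (hμ : μ ∈ C) :
      P.projObj μt wt μ' + P.projObj μ' w' μ ≤ P.projObj μt wt μ := by
    rw [← projObj_three_point hc hd hw hw']
    exact add_le_of_nonpos_right (EReal.coe_nonpos.2 (hN.2 μ hμ))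
  refine Set.Subset.antisymm (fun μ hμ => ?_) (Set.singleton_subset_iff.2 ⟨hN.1, fun μ hμ => ?_⟩)
  · refine eq_of_projObj_nonpos hc hd hw' ?_
    have hμ' : P.fstar μ'.fst = ((⟪μ'.fst, w'⟫ - P.f w' : ℝ) : EReal) :=
      hilbertConj_of_mem_subdiff hc (hd w') hw'
    have hle := (hgrowth hμ.1).trans (hμ.2 hN.1)
    rw [projObj_eq_fstar_add hc hd hw, hμ', ← EReal.coe_add] at hle
    exact (EReal.addLECancellable_coe _).add_le_iff_nonpos_right.1 hle
  · exact (le_add_of_nonneg_right (projObj_nonneg hc hd hw')).trans (hgrowth hμ)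

end ProjObj

/-! ### The Fenchel–Rockafellar form of the projection problem -/

section Reformulation

variable {E₁ E₂ : Type*} [NormedAddCommGroup E₁] [InnerProductSpace ℝ E₁]
  [NormedAddCommGroup E₂] [InnerProductSpace ℝ E₂] {P : Problem E₁ E₂}

namespace Problem

section PrimalF

variable {μt : WithLp 2 (E₁ × E₂)} {wt : E₁} {p : WithLp 2 (E₁ × E₂) × ℝ}

lemma primalF_eq_coe (hz : P.fstar p.1.fst ≤ p.2) (hQ : p.1.snd ∈ P.Q) : P.primalF μt wt p
    = ((p.2 - ⟪p.1.fst, wt⟫ + 1 / 2 * ‖p.1.snd‖ ^ 2 - ⟪p.1.snd, μt.snd⟫ : ℝ) : EReal) := by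
  have hepi : (p.1.fst, p.2) ∈ {q : E₁ × ℝ | P.fstar q.1 ≤ (q.2 : EReal)} := hz
  rw [primalF, ind_of_mem hepi, ind_of_mem hQ, add_zero, add_zero]

lemma primalF_ne_bot : P.primalF μt wt p ≠ ⊥ :=
  EReal.add_ne_bot_iff.2
    ⟨EReal.add_ne_bot_iff.2 ⟨EReal.coe_ne_bot _, ind_ne_bot _ _⟩, ind_ne_bot _ _⟩

lemma primalF_ne_top_iff :
    P.primalF μt wt p ≠ ⊤ ↔ P.fstar p.1.fst ≤ p.2 ∧ p.1.snd ∈ P.Q := by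
  refine ⟨fun h => ?_, fun h => primalF_eq_coe h.1 h.2 ▸ EReal.coe_ne_top _⟩
  obtain ⟨hsum, hQ⟩ := (EReal.add_ne_top_iff_ne_top₂
    (EReal.add_ne_bot_iff.2 ⟨EReal.coe_ne_bot _, ind_ne_bot _ _⟩) (ind_ne_bot _ _)).1 h
  exact ⟨mem_of_ind_ne_top
    ((EReal.add_ne_top_iff_ne_top₂ (EReal.coe_ne_bot _) (ind_ne_bot _ _)).1 hsum).2,
    mem_of_ind_ne_top hQ⟩

end PrimalF

lemma toLp_neg_mem_graphNeg {S : Set E₁} {v : E₁} (hv : v ∈ S) :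
    WithLp.toLp 2 (-v, P.A (-v)) ∈ P.graphNeg S :=
  ⟨(neg_neg v).symm ▸ hv, rfl⟩

variable [CompleteSpace E₁] [CompleteSpace E₂]
  {μt μ : WithLp 2 (E₁ × E₂)} {wt : E₁} {S : Set E₁} {ℓ z r : ℝ}

lemma inner_oracleDir (μ : WithLp 2 (E₁ × E₂)) (x : E₁) :
    ⟪P.oracleDir μ, x⟫ = ⟪μ.fst, x⟫ + ⟪μ.snd, P.A x⟫ := by
  rw [oracleDir, inner_add_left, ContinuousLinearMap.adjoint_inner_left]

lemma primalL_apply (p : WithLp 2 (E₁ × E₂) × ℝ) (v : S) :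
    P.primalL S p v = p.2 + ⟪p.1.snd, P.b⟫ - ⟪P.oracleDir p.1, v⟫ := rfl

lemma inner_of_mem_graphNeg {x : WithLp 2 (E₁ × E₂)} (hx : x ∈ P.graphNeg S) :
    ⟪μ, x⟫ = -⟪P.oracleDir μ, -x.fst⟫ := by
  rw [inner_neg_right, neg_neg, inner_oracleDir, ← hx.2]
  exact WithLp.prod_inner_apply μ x

lemma neg_inner_le_supportFn_graphNeg {v : E₁} (hv : v ∈ S) :
    ((-⟪P.oracleDir μ, v⟫ : ℝ) : EReal) ≤ supportFn (P.graphNeg S) μ := by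
  have hmem := toLp_neg_mem_graphNeg (P := P) hv
  have hinner : ⟪μ, WithLp.toLp 2 (-v, P.A (-v))⟫ = -⟪P.oracleDir μ, v⟫ := by
    rw [inner_of_mem_graphNeg hmem]
    exact congrArg (fun x => -⟪P.oracleDir μ, x⟫) (neg_neg v)
  rw [← hinner]
  exact le_iSup₂ (f := fun x (_ : x ∈ P.graphNeg S) => ((⟪μ, x⟫ : ℝ) : EReal)) _ hmem

lemma supportFn_graphNeg_le_iff {c : ℝ} :
    supportFn (P.graphNeg S) μ ≤ c ↔ ∀ v ∈ S, -⟪P.oracleDir μ, v⟫ ≤ c := by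
  refine ⟨fun h v hv => EReal.coe_le_coe_iff.1 ((neg_inner_le_supportFn_graphNeg hv).trans h),
    fun h => iSup₂_le fun x hx => EReal.coe_le_coe_iff.2 ?_⟩
  rw [inner_of_mem_graphNeg hx]
  exact h _ hx.1

/-- Feasibility of `(μ, z)` in the Fenchel–Rockafellar form `minimize F (μ, z) + G (L (μ, z))` of
the projection problem: the conditions under which the objective is finite. -/
structure IsFeasible (P : Problem E₁ E₂) (S : Set E₁) (ℓ : ℝ) (μ : WithLp 2 (E₁ × E₂)) (z : ℝ) :
    Prop where
  fstar_le : P.fstar μ.fst ≤ z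
  snd_mem : μ.snd ∈ P.Q
  primalL_le : ∀ v : S, P.primalL S (μ, z) v ≤ ℓ

lemma mem_levelSet_iff_isFeasible (hr : P.fstar μ.fst = r) (hQ : μ.snd ∈ P.Q) :
    μ ∈ P.levelSet S ℓ ↔ P.IsFeasible S ℓ μ r := by
  have hpsi : P.psi μ = ((r + ⟪μ.snd, P.b⟫ : ℝ) : EReal) := by
    rw [psi, hr, ind_of_mem hQ, add_zero, EReal.coe_add]
  have hlevel : μ ∈ P.levelSet S ℓ ↔ ∀ v : S, P.primalL S (μ, r) v ≤ ℓ := by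
    rw [levelSet, Set.mem_ofPred_eq, hpsi, add_comm, ← EReal.le_sub_iff_add_le
      (.inl (EReal.coe_ne_bot _)) (.inl (EReal.coe_ne_top _)), ← EReal.coe_sub,
      supportFn_graphNeg_le_iff, Subtype.forall]
    refine forall₂_congr fun v hv => ?_
    rw [primalL_apply]
    constructor <;> intro h <;> linarith
  exact hlevel.trans ⟨fun h => ⟨hr.le, hQ, h⟩, fun h => h.primalL_le⟩

lemma mem_levelSet_iff (hS : S.Nonempty) :
    μ ∈ P.levelSet S ℓ ↔ ∃ r : ℝ, P.fstar μ.fst = r ∧ P.IsFeasible S ℓ μ r := by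
  refine ⟨fun h => ?_, fun ⟨r, hr, hfeas⟩ => (mem_levelSet_iff_isFeasible hr hfeas.snd_mem).2 hfeas⟩
  obtain ⟨v, hv⟩ := hS
  have hsupp : supportFn (P.graphNeg S) μ ≠ ⊥ :=
    ne_bot_of_le_ne_bot (EReal.coe_ne_bot _) (neg_inner_le_supportFn_graphNeg hv)
  have hfstar_ne_bot : P.fstar μ.fst ≠ ⊥ := hilbertConj_ne_bot μ.fst
  have hsum_ne_bot : P.fstar μ.fst + ind P.Q μ.snd ≠ ⊥ :=
    EReal.add_ne_bot_iff.2 ⟨hfstar_ne_bot, ind_ne_bot _ _⟩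
  have hpsi : P.psi μ ≠ ⊤ :=
    ((EReal.add_ne_top_iff_ne_top₂
      (EReal.add_ne_bot_iff.2 ⟨hsum_ne_bot, EReal.coe_ne_bot _⟩) hsupp).1
      (ne_top_of_le_ne_top (EReal.coe_ne_top ℓ) h)).1
  obtain ⟨hfstar, hind⟩ := (EReal.add_ne_top_iff_ne_top₂ hfstar_ne_bot (ind_ne_bot _ _)).1
    ((EReal.add_ne_top_iff_ne_top₂ hsum_ne_bot (EReal.coe_ne_bot _)).1 hpsi).1
  obtain ⟨r, hr⟩ : ∃ r : ℝ, P.fstar μ.fst = r := exists_hilbertConj_eq_coe hfstar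
  exact ⟨r, hr, (mem_levelSet_iff_isFeasible hr (mem_of_ind_ne_top hind)).1 h⟩

lemma IsFeasible.exists_fstar_eq (h : P.IsFeasible S ℓ μ z) :
    ∃ r : ℝ, P.fstar μ.fst = r ∧ r ≤ z ∧ P.IsFeasible S ℓ μ r := by
  obtain ⟨r, hr⟩ : ∃ r : ℝ, P.fstar μ.fst = r :=
    exists_hilbertConj_eq_coe (ne_top_of_le_ne_top (EReal.coe_ne_top z) h.fstar_le)
  have hrz : r ≤ z := EReal.coe_le_coe_iff.1 (hr ▸ h.fstar_le)
  refine ⟨r, hr, hrz, hr.le, h.snd_mem, fun v => ?_⟩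
  have hv := h.primalL_le v
  rw [primalL_apply] at hv ⊢
  linarith

/-- The objective `F + G ∘ L` of the Fenchel–Rockafellar form of the projection problem. -/
noncomputable abbrev primalObj (P : Problem E₁ E₂) (μt : WithLp 2 (E₁ × E₂)) (wt : E₁)
    (S : Set E₁) (ℓ : ℝ) : WithLp 2 (E₁ × E₂) × ℝ → EReal :=
  fenchelPrimalObj (P.primalF μt wt) (primalG S ℓ) (P.primalL S)

lemma IsFeasible.primalObj_eq_primalF (h : P.IsFeasible S ℓ μ z) :
    P.primalObj μt wt S ℓ (μ, z) = P.primalF μt wt (μ, z) := by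
  have hL : P.primalL S (μ, z) ∈ {φ : C(S, ℝ) | ∀ v, φ v - ℓ ≤ 0} := fun v =>
    sub_nonpos.2 (h.primalL_le v)
  rw [primalObj, fenchelPrimalObj, primalG, ind_of_mem hL, add_zero]

lemma IsFeasible.primalObj_eq_coe (h : P.IsFeasible S ℓ μ z) : P.primalObj μt wt S ℓ (μ, z)
    = ((z - ⟪μ.fst, wt⟫ + 1 / 2 * ‖μ.snd‖ ^ 2 - ⟪μ.snd, μt.snd⟫ : ℝ) : EReal) :=
  h.primalObj_eq_primalF.trans (primalF_eq_coe (p := (μ, z)) h.fstar_le h.snd_mem)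

lemma primalObj_ne_top_iff :
    P.primalObj μt wt S ℓ (μ, z) ≠ ⊤ ↔ P.IsFeasible S ℓ μ z := by
  refine ⟨fun h => ?_, fun h => h.primalObj_eq_coe ▸ EReal.coe_ne_top _⟩
  obtain ⟨hF, hG⟩ := (EReal.add_ne_top_iff_ne_top₂ primalF_ne_bot (ind_ne_bot _ _)).1 h
  obtain ⟨hz, hQ⟩ := primalF_ne_top_iff.1 hF
  exact ⟨hz, hQ, fun v => sub_nonpos.1 (mem_of_ind_ne_top hG v)⟩

variable (hc : ConvexOn ℝ Set.univ P.f) (hd : Differentiable ℝ P.f)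
  (hw : wt ∈ subdiff P.fstar μt.fst)

include hc hd hw

lemma IsFeasible.primalObj_eq_projObj_add (h : P.IsFeasible S ℓ μ z) (hr : P.fstar μ.fst = r) :
    P.primalObj μt wt S ℓ (μ, z)
      = P.projObj μt wt μ + ((P.shift μt wt + (z - r) : ℝ) : EReal) := by
  rw [h.primalObj_eq_coe, projObj_eq_fstar_add hc hd hw,
    hr, ← EReal.coe_add, ← EReal.coe_add, shift, norm_sub_sq_real]
  congr 1
  ring

lemma IsFeasible.primalObj_eq_projObj_add_shift (h : P.IsFeasible S ℓ μ r)
    (hr : P.fstar μ.fst = r) :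
    P.primalObj μt wt S ℓ (μ, r) = P.projObj μt wt μ + (P.shift μt wt : EReal) := by
  rw [h.primalObj_eq_projObj_add hc hd hw hr, sub_self, add_zero]

lemma mem_argminOn_primalObj_iff (hS : S.Nonempty) (hne : (P.levelSet S ℓ).Nonempty) :
    (μ, z) ∈ argminOn (P.primalObj μt wt S ℓ) Set.univ ↔
      (z : EReal) = P.fstar μ.fst ∧ μ ∈ argminOn (P.projObj μt wt) (P.levelSet S ℓ) := by
  constructor
  · rintro ⟨-, hmin⟩
    have hle (q) : P.primalObj μt wt S ℓ (μ, z) ≤ P.primalObj μt wt S ℓ q := hmin (Set.mem_univ q)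
    obtain ⟨μ₀, hμ₀⟩ := hne
    obtain ⟨r₀, -, hfeas₀⟩ := (mem_levelSet_iff hS).1 hμ₀
    have hfeas : P.IsFeasible S ℓ μ z := primalObj_ne_top_iff.1
      (ne_top_of_le_ne_top (primalObj_ne_top_iff.2 hfeas₀) (hle (μ₀, r₀)))
    obtain ⟨r, hr, hrz, hfeas_r⟩ := hfeas.exists_fstar_eq
    obtain rfl : z = r := by
      have hzr := hle (μ, r)
      rw [hfeas.primalObj_eq_coe, hfeas_r.primalObj_eq_coe, EReal.coe_le_coe_iff] at hzr
      linarith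
    refine ⟨hr.symm, (mem_levelSet_iff hS).2 ⟨z, hr, hfeas⟩, fun μ₁ hμ₁ => ?_⟩
    obtain ⟨r₁, hr₁, hfeas₁⟩ := (mem_levelSet_iff hS).1 hμ₁
    have hle₁ := hle (μ₁, r₁)
    rw [hfeas.primalObj_eq_projObj_add_shift hc hd hw hr,
      hfeas₁.primalObj_eq_projObj_add_shift hc hd hw hr₁] at hle₁
    exact (EReal.addLECancellable_coe _).add_le_add_iff_right.1 hle₁
  · rintro ⟨hz, hμ, hmin⟩
    refine ⟨Set.mem_univ _, fun ⟨μ₁, z₁⟩ _ => ?_⟩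
    by_cases htop : P.primalObj μt wt S ℓ (μ₁, z₁) = ⊤
    · exact le_top.trans_eq htop.symm
    have hfeas₁ := primalObj_ne_top_iff.1 htop
    obtain ⟨r₁, hr₁, hrz₁, hfeas_r₁⟩ := hfeas₁.exists_fstar_eq
    have hfeas := (mem_levelSet_iff_isFeasible hz.symm
      ((mem_levelSet_iff hS).1 hμ).choose_spec.2.snd_mem).1 hμ
    rw [Set.mem_ofPred_eq, hfeas.primalObj_eq_projObj_add_shift hc hd hw hz.symm,
      hfeas₁.primalObj_eq_projObj_add hc hd hw hr₁]
    exact add_le_add (hmin ((mem_levelSet_iff hS).2 ⟨r₁, hr₁, hfeas_r₁⟩))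
      (EReal.coe_le_coe_iff.2 (by linarith))

lemma iInf_primalObj_eq (hS : S.Nonempty)
    (hμ : μ ∈ argminOn (P.projObj μt wt) (P.levelSet S ℓ)) :
    ⨅ p, P.primalObj μt wt S ℓ p
      = (⨅ μ ∈ P.levelSet S ℓ, P.projObj μt wt μ) + (P.shift μt wt : EReal) := by
  obtain ⟨r, hr, hfeas⟩ := (mem_levelSet_iff hS).1 hμ.1
  have hmin := iInf_eq_of_mem_argminOn
    ((mem_argminOn_primalObj_iff hc hd hw hS ⟨μ, hμ.1⟩).2 ⟨hr.symm, hμ⟩)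
  rw [iInf_univ] at hmin
  rw [iInf_eq_of_mem_argminOn hμ, hmin, hfeas.primalObj_eq_projObj_add_shift hc hd hw hr]

end Problem

end Reformulation

/-! ### The Fenchel dual of the projection problem -/

section ConstraintConjugate

variable {E₁ : Type*} [NormedAddCommGroup E₁] {S : Set E₁} {ℓ : ℝ} {φ : StrongDual ℝ C(S, ℝ)}

lemma sub_le_fenchelConj_primalG (φ : StrongDual ℝ C(S, ℝ)) {g : C(S, ℝ)} (hg : ∀ v, g v ≤ ℓ) :
    ((φ g : ℝ) : EReal) ≤ fenchelConj (primalG S ℓ) φ := by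
  have hmem : g ∈ {φ : C(S, ℝ) | ∀ v, φ v - ℓ ≤ 0} := fun v => sub_nonpos.2 (hg v)
  simpa only [primalG, ind_of_mem hmem, sub_zero] using sub_le_fenchelConj (primalG S ℓ) φ g

lemma nonneg_of_fenchelConj_primalG_ne_top (h : fenchelConj (primalG S ℓ) φ ≠ ⊤) {g : C(S, ℝ)}
    (hg : ∀ v, 0 ≤ g v) : 0 ≤ φ g := by
  let c : C(S, ℝ) := ContinuousMap.const S ℓ
  have hbot : fenchelConj (primalG S ℓ) φ ≠ ⊥ :=
    ne_bot_of_le_ne_bot (EReal.coe_ne_bot _) (sub_le_fenchelConj_primalG φ (g := c) fun _ => le_rfl)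
  lift fenchelConj (primalG S ℓ) φ to ℝ using ⟨h, hbot⟩ with B hB
  by_contra! hneg
  obtain ⟨n, hn⟩ := exists_nat_gt ((B - φ c) / -φ g)
  have hle := sub_le_fenchelConj_primalG φ (g := c - (n : ℝ) • g) fun v =>
    sub_le_self ℓ (mul_nonneg n.cast_nonneg (hg v))
  rw [← hB, EReal.coe_le_coe_iff, map_sub, map_smul, smul_eq_mul] at hle
  rw [div_lt_iff₀ (neg_pos.2 hneg)] at hn
  linarith

variable [MeasurableSpace E₁] [BorelSpace E₁]

lemma fenchelConj_primalG_eq_of_integral (hS : IsCompact S) (ℓ : ℝ) {ν : Measure S}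
    [IsFiniteMeasure ν] (hφ : ∀ g : C(S, ℝ), φ g = ∫ v, g v ∂ν) :
    fenchelConj (primalG S ℓ) φ = ((ℓ * ν.real Set.univ : ℝ) : EReal) := by
  have : CompactSpace S := isCompact_iff_compactSpace.mp hS
  have hconst : ∫ _ : S, ℓ ∂ν = ℓ * ν.real Set.univ := by
    rw [integral_const, smul_eq_mul, mul_comm]
  refine le_antisymm (iSup_le fun g => ?_) ?_
  · by_cases hg : g ∈ {φ : C(S, ℝ) | ∀ v, φ v - ℓ ≤ 0}
    · rw [primalG, ind_of_mem hg, sub_zero, EReal.coe_le_coe_iff, hφ, ← hconst]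
      exact integral_mono (integrable_continuousMap g ν) (integrable_const ℓ)
        fun v => sub_nonpos.1 (hg v)
    · rw [primalG, ind_of_notMem hg, EReal.sub_top]
      exact bot_le
  · rw [← hconst]
    exact (EReal.coe_le_coe_iff.2 (hφ (ContinuousMap.const S ℓ)).ge).trans
      (sub_le_fenchelConj_primalG φ fun _ => le_rfl)

end ConstraintConjugate

section Moments

variable {E₁ E₂ : Type*} [NormedAddCommGroup E₁] [InnerProductSpace ℝ E₁]
  [NormedAddCommGroup E₂] [InnerProductSpace ℝ E₂]

namespace Problem

/-- The assumptions on `f` and `Q` under which a single dual update is analysed. -/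
structure Regular (P : Problem E₁ E₂) : Prop where
  f_convex : ConvexOn ℝ Set.univ P.f
  f_differentiable : Differentiable ℝ P.f
  Q_nonempty : P.Q.Nonempty
  Q_closed : IsClosed P.Q
  Q_convex : Convex ℝ P.Q

/-- `Problem.nextW` at a signed measure `-ν`, as a function of the mean `x` and of the total mass
`s` of `ν`. -/
noncomputable def momentW (wt x : E₁) (s : ℝ) : E₁ := (1 + s)⁻¹ • (x + wt)

/-- `Problem.muTilde` at a signed measure `-ν`, as a function of the mean `x` and of the total mass
`s` of `ν`. -/
def momentMuTilde (P : Problem E₁ E₂) (μt : WithLp 2 (E₁ × E₂)) (x : E₁) (s : ℝ) : E₂ :=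
  P.A x - s • P.b + μt.snd

/-- `Problem.explObj` at a signed measure `-ν`, as a function of the mean `x` and of the total mass
`s` of `ν`. -/
noncomputable def momentObj (P : Problem E₁ E₂) (μt : WithLp 2 (E₁ × E₂)) (wt : E₁) (ℓ : ℝ)
    (x : E₁) (s : ℝ) : ℝ :=
  (1 + s) * P.f (momentW wt x s) + projPotential P.Q (P.momentMuTilde μt x s) + ℓ * s

variable [CompleteSpace E₁]

/-- The maximizer of `p ↦ -∫ L p dν - F p`, where `ν` is a measure with mean `x` and total mass `s`:
its first component is `Problem.nextMu` at `-ν`, and the second one is the value of the conjugate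
of `f` there. -/
noncomputable def momentPoint (P : Problem E₁ E₂) (μt : WithLp 2 (E₁ × E₂)) (wt x : E₁) (s : ℝ) :
    WithLp 2 (E₁ × E₂) × ℝ :=
  (WithLp.toLp 2 (gradient P.f (momentW wt x s), projOn P.Q (P.momentMuTilde μt x s)),
    ⟪gradient P.f (momentW wt x s), momentW wt x s⟫ - P.f (momentW wt x s))

variable {P : Problem E₁ E₂} {μt : WithLp 2 (E₁ × E₂)} {wt x : E₁} {s : ℝ}

lemma Regular.fstar_momentPoint (hP : P.Regular) :
    P.fstar (P.momentPoint μt wt x s).1.fst = (P.momentPoint μt wt x s).2 :=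
  hilbertConj_gradient hP.f_convex (hP.f_differentiable _)

variable [CompleteSpace E₂]

/-- The integral of `Problem.primalL` at `p` against a measure with mean `x` and total mass `s`. -/
noncomputable def momentL (P : Problem E₁ E₂) (p : WithLp 2 (E₁ × E₂) × ℝ) (x : E₁) (s : ℝ) : ℝ :=
  s * (p.2 + ⟪p.1.snd, P.b⟫) - ⟪P.oracleDir p.1, x⟫

lemma neg_momentL_sub_eq (hs : 1 + s ≠ 0) (p : WithLp 2 (E₁ × E₂) × ℝ) :
    -P.momentL p x s - (p.2 - ⟪p.1.fst, wt⟫ + 1 / 2 * ‖p.1.snd‖ ^ 2 - ⟪p.1.snd, μt.snd⟫)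
      = (1 + s) * (⟪p.1.fst, momentW wt x s⟫ - p.2)
        + (⟪p.1.snd, P.momentMuTilde μt x s⟫ - 1 / 2 * ‖p.1.snd‖ ^ 2) := by
  rw [momentL, momentW, momentMuTilde, inner_oracleDir, mul_sub, inner_smul_right,
    mul_inv_cancel_left₀ hs]
  simp only [inner_add_right, inner_sub_right, inner_smul_right]
  ring

lemma Regular.momentPoint_snd_mem (hP : P.Regular) : (P.momentPoint μt wt x s).1.snd ∈ P.Q :=
  projOn_mem hP.Q_nonempty hP.Q_closed hP.Q_convex _

lemma Regular.primalF_momentPoint (hP : P.Regular) (hs : 1 + s ≠ 0) :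
    P.primalF μt wt (P.momentPoint μt wt x s)
      = ((-P.momentL (P.momentPoint μt wt x s) x s - P.momentObj μt wt 0 x s : ℝ) : EReal) := by
  rw [primalF_eq_coe hP.fstar_momentPoint.le hP.momentPoint_snd_mem]
  have hL := neg_momentL_sub_eq (P := P) (μt := μt) (wt := wt) (x := x) hs
    (P.momentPoint μt wt x s)
  have hfst : (P.momentPoint μt wt x s).2
      = ⟪(P.momentPoint μt wt x s).1.fst, momentW wt x s⟫ - P.f (momentW wt x s) := rfl
  have hsnd : projPotential P.Q (P.momentMuTilde μt x s)
      = ⟪(P.momentPoint μt wt x s).1.snd, P.momentMuTilde μt x s⟫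
        - 1 / 2 * ‖(P.momentPoint μt wt x s).1.snd‖ ^ 2 :=
    projPotential_eq_inner_projOn hP.Q_nonempty hP.Q_closed hP.Q_convex _
  have hobj : P.momentObj μt wt 0 x s = (1 + s) * (⟪(P.momentPoint μt wt x s).1.fst,
      momentW wt x s⟫ - (P.momentPoint μt wt x s).2)
      + projPotential P.Q (P.momentMuTilde μt x s) := by
    rw [momentObj, zero_mul, add_zero, hfst, sub_sub_cancel]
  congr 1
  linarith

lemma neg_momentL_sub_primalF_le (hs : 0 ≤ s) (p : WithLp 2 (E₁ × E₂) × ℝ) :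
    ((-P.momentL p x s : ℝ) : EReal) - P.primalF μt wt p ≤ P.momentObj μt wt 0 x s := by
  by_cases htop : P.primalF μt wt p = ⊤
  · rw [htop, EReal.sub_top]
    exact bot_le
  obtain ⟨hz, hQ⟩ := primalF_ne_top_iff.1 htop
  rw [primalF_eq_coe hz hQ, ← EReal.coe_sub, EReal.coe_le_coe_iff,
    neg_momentL_sub_eq (by positivity), momentObj, zero_mul, add_zero]
  refine add_le_add (mul_le_mul_of_nonneg_left ?_ (by positivity))
    (inner_sub_half_norm_sq_le_projPotential _ hQ)
  linarith [inner_sub_le_of_hilbertConj_le hz (momentW wt x s)]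

lemma Regular.fenchelConj_primalF (hP : P.Regular) (hs : 0 ≤ s)
    {ψ : StrongDual ℝ (WithLp 2 (E₁ × E₂) × ℝ)} (hψ : ∀ p, ψ p = -P.momentL p x s) :
    fenchelConj (P.primalF μt wt) ψ = (P.momentObj μt wt 0 x s : EReal) := by
  refine le_antisymm (iSup_le fun p => hψ p ▸ neg_momentL_sub_primalF_le hs p) ?_
  refine le_trans (le_of_eq ?_) (sub_le_fenchelConj _ ψ (P.momentPoint μt wt x s))
  rw [hP.primalF_momentPoint (by positivity), hψ, ← EReal.coe_sub, sub_sub_cancel]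

lemma Regular.fenchelConj_primalF_ne_bot (hP : P.Regular)
    (ψ : StrongDual ℝ (WithLp 2 (E₁ × E₂) × ℝ)) : fenchelConj (P.primalF μt wt) ψ ≠ ⊥ :=
  fenchelConj_ne_bot (x := P.momentPoint μt wt 0 0)
    (primalF_ne_top_iff.2 ⟨hP.fstar_momentPoint.le, hP.momentPoint_snd_mem⟩) ψ

end Problem

end Moments

lemma perspective_ne_bot {H : Type*} [NormedAddCommGroup H] [InnerProductSpace ℝ H] (f : H → ℝ)
    (x : H) (s : ℝ) : perspective f x s ≠ ⊥ := by
  unfold perspective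
  split_ifs
  · exact EReal.coe_ne_bot _
  · exact ne_bot_of_le_ne_bot (EReal.coe_ne_bot _)
      (le_iSup (fun y : H => ((f (y + x) - f y : ℝ) : EReal)) 0)
  · exact top_ne_bot

section MeasureMoments

variable {E₁ E₂ : Type*} [NormedAddCommGroup E₁] [InnerProductSpace ℝ E₁]
  [NormedAddCommGroup E₂] [InnerProductSpace ℝ E₂] [MeasurableSpace E₁]

namespace Problem

variable {P : Problem E₁ E₂} {μt : WithLp 2 (E₁ × E₂)} {wt : E₁} {S : Set E₁} {ℓ : ℝ}

lemma explObj_ne_bot (m : SignedMeasure S) : P.explObj μt wt S ℓ m ≠ ⊥ :=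
  EReal.add_ne_bot_iff.2 ⟨perspective_ne_bot _ _ _, EReal.coe_ne_bot _⟩

variable (ν : Measure S) [IsFiniteMeasure ν]

lemma nextW_neg_toSignedMeasure : nextW wt S (-ν.toSignedMeasure)
    = momentW wt (∫ v, (v : E₁) ∂ν) (ν.real Set.univ) := by
  rw [nextW, mean_neg_toSignedMeasure, neg_toSignedMeasure_univ, sub_neg_eq_add, sub_neg_eq_add,
    add_comm wt, momentW]

lemma muTilde_neg_toSignedMeasure : P.muTilde μt S (-ν.toSignedMeasure)
    = P.momentMuTilde μt (∫ v, (v : E₁) ∂ν) (ν.real Set.univ) := by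
  rw [muTilde, mean_neg_toSignedMeasure, neg_toSignedMeasure_univ, momentMuTilde, map_neg, neg_neg,
    neg_smul, sub_eq_add_neg]

lemma explObj_neg_toSignedMeasure : P.explObj μt wt S ℓ (-ν.toSignedMeasure)
    = (P.momentObj μt wt ℓ (∫ v, (v : E₁) ∂ν) (ν.real Set.univ) : EReal) := by
  have hs : 0 < 1 + ν.real Set.univ := by positivity
  rw [explObj, muTilde_neg_toSignedMeasure, mean_neg_toSignedMeasure, neg_toSignedMeasure_univ,
    perspective, sub_neg_eq_add, if_pos hs, ← EReal.coe_add, neg_neg, momentObj, momentW,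
    projPotential]
  congr 1
  ring

lemma nextMu_neg_toSignedMeasure [CompleteSpace E₁] : P.nextMu μt wt S (-ν.toSignedMeasure)
    = (P.momentPoint μt wt (∫ v, (v : E₁) ∂ν) (ν.real Set.univ)).1 := by
  have hsnd : μt.snd + (-ν.toSignedMeasure) Set.univ • P.b - P.A (mean S (-ν.toSignedMeasure))
      = P.muTilde μt S (-ν.toSignedMeasure) := by
    rw [muTilde]
    abel
  rw [nextMu, nextW_neg_toSignedMeasure, hsnd, muTilde_neg_toSignedMeasure, momentPoint]

variable [BorelSpace E₁] [CompleteSpace E₁] [CompleteSpace E₂]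

lemma integral_primalL (hS : IsCompact S) (p : WithLp 2 (E₁ × E₂) × ℝ) :
    ∫ v, P.primalL S p v ∂ν = P.momentL p (∫ v, (v : E₁) ∂ν) (ν.real Set.univ) := by
  have hint := integrable_coe hS ν
  calc ∫ v, P.primalL S p v ∂ν
      = ∫ v : S, (p.2 + ⟪p.1.snd, P.b⟫ - ⟪P.oracleDir p.1, (v : E₁)⟫) ∂ν := rfl
    _ = _ := by
      rw [integral_sub (integrable_const _) (hint.const_inner _), integral_const, smul_eq_mul,
        integral_inner hint, momentL]

end Problem

end MeasureMoments

section Dual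

variable {E₁ E₂ : Type*} [NormedAddCommGroup E₁] [InnerProductSpace ℝ E₁] [CompleteSpace E₁]
  [NormedAddCommGroup E₂] [InnerProductSpace ℝ E₂] [CompleteSpace E₂] [MeasurableSpace E₁]
  [BorelSpace E₁]

namespace Problem

variable {P : Problem E₁ E₂} {μt : WithLp 2 (E₁ × E₂)} {wt : E₁} {S : Set E₁} {ℓ : ℝ}
  {φ : StrongDual ℝ C(S, ℝ)}

lemma Regular.exists_represents_of_fenchelDualObj_ne_top (hP : P.Regular) (hS : IsCompact S)
    (h : fenchelDualObj (P.primalF μt wt) (primalG S ℓ) (P.primalL S) φ ≠ ⊤) :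
    ∃ m : SignedMeasure S, m ≤ 0 ∧ Represents φ m := by
  have hG : fenchelConj (primalG S ℓ) (-φ) ≠ ⊤ := fun htop =>
    h (by rw [fenchelDualObj, htop, EReal.add_top_of_ne_bot (hP.fenchelConj_primalF_ne_bot _)])
  exact exists_represents_of_nonpos hS fun g hg =>
    neg_nonneg.1 (nonneg_of_fenchelConj_primalG_ne_top hG hg)

lemma Regular.fenchelDualObj_eq_momentObj (hP : P.Regular) (hS : IsCompact S) {ν : Measure S}
    [IsFiniteMeasure ν] (h : Represents φ (-ν.toSignedMeasure)) :
    fenchelDualObj (P.primalF μt wt) (primalG S ℓ) (P.primalL S) φ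
      = (P.momentObj μt wt ℓ (∫ v, (v : E₁) ∂ν) (ν.real Set.univ) : EReal) := by
  have hφ (g : C(S, ℝ)) : φ g = -∫ v, g v ∂ν := by rw [h g, integral_neg_toSignedMeasure]
  have hF : fenchelConj (P.primalF μt wt) (φ.comp (P.primalL S))
      = (P.momentObj μt wt 0 (∫ v, (v : E₁) ∂ν) (ν.real Set.univ) : EReal) :=
    hP.fenchelConj_primalF measureReal_nonneg fun p => by
      rw [ContinuousLinearMap.comp_apply, hφ, integral_primalL ν hS]
  have hG : fenchelConj (primalG S ℓ) (-φ) = ((ℓ * ν.real Set.univ : ℝ) : EReal) :=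
    fenchelConj_primalG_eq_of_integral hS ℓ fun g => by rw [neg_apply, hφ, neg_neg]
  rw [fenchelDualObj, hF, hG, ← EReal.coe_add, momentObj, momentObj, zero_mul, add_zero]

lemma Regular.fenchelDualObj_eq_explObj_add_ind (hP : P.Regular) (hS : IsCompact S)
    {m : SignedMeasure S} (h : Represents φ m) :
    fenchelDualObj (P.primalF μt wt) (primalG S ℓ) (P.primalL S) φ
      = P.explObj μt wt S ℓ m + ind {m | m ≤ 0} m := by
  by_cases hm : m ∈ {m : SignedMeasure S | m ≤ 0}
  · obtain ⟨ν, _, rfl⟩ := exists_eq_neg_toSignedMeasure hm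
    rw [ind_of_mem hm, add_zero, explObj_neg_toSignedMeasure, hP.fenchelDualObj_eq_momentObj hS h]
  · rw [ind_of_notMem hm, EReal.add_top_of_ne_bot (explObj_ne_bot m)]
    by_contra hne
    obtain ⟨m', hm', h'⟩ := hP.exists_represents_of_fenchelDualObj_ne_top hS hne
    exact hm (represents_unique hS h h' ▸ hm')

end Problem

end Dual

/-! ### Optimality conditions -/

section FirstOrder

lemma nonneg_of_hasDerivAt_of_isMinOn_Icc {φ : ℝ → ℝ} {d : ℝ} (hd : HasDerivAt φ d 0)
    (hmin : IsMinOn φ (Set.Icc 0 1) 0) : 0 ≤ d := by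
  have hcone : (1 : ℝ) ∈ posTangentConeAt (Set.Icc (0 : ℝ) 1) 0 :=
    mem_posTangentConeAt_of_segment_subset (by rw [zero_add, segment_eq_Icc zero_le_one])
  simpa using hmin.localize.hasFDerivWithinAt_nonneg hd.hasFDerivAt.hasFDerivWithinAt hcone

lemma hasDerivAt_perspective {H : Type*} [NormedAddCommGroup H] [InnerProductSpace ℝ H]
    [CompleteSpace H] {f : H → ℝ} {c : ℝ → ℝ} {z : ℝ → H} {c' t : ℝ} {z' y : H}
    (hc : HasDerivAt c c' t) (hz : HasDerivAt z z' t) (ht : c t ≠ 0) (hy : y = (c t)⁻¹ • z t)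
    (hf : DifferentiableAt ℝ f y) :
    HasDerivAt (fun τ => c τ * f ((c τ)⁻¹ • z τ))
      (⟪gradient f y, z'⟫ + c' * (f y - ⟪gradient f y, y⟫)) t := by
  subst hy
  have hcomp := hasDerivAt_comp_of_hasGradientAt (c := fun τ => (c τ)⁻¹ • z τ) hf.hasGradientAt
    ((hc.fun_inv ht).fun_smul hz)
  refine (hc.fun_mul hcomp).congr_deriv ?_
  simp only [inner_add_right, inner_smul_right]
  field_simp
  ring

variable {E₁ E₂ : Type*} [NormedAddCommGroup E₁] [InnerProductSpace ℝ E₁] [CompleteSpace E₁]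
  [NormedAddCommGroup E₂] [InnerProductSpace ℝ E₂] [CompleteSpace E₂]

namespace Problem

variable {P : Problem E₁ E₂} {μt : WithLp 2 (E₁ × E₂)} {wt x x' : E₁} {ℓ s s' : ℝ}

lemma Regular.hasDerivAt_momentObj (hP : P.Regular) (hs : 1 + s ≠ 0) :
    HasDerivAt (fun ε : ℝ => P.momentObj μt wt ℓ (AffineMap.lineMap x x' ε)
        (AffineMap.lineMap s s' ε))
      (ℓ * (s' - s) - (P.momentL (P.momentPoint μt wt x s) x' s'
        - P.momentL (P.momentPoint μt wt x s) x s)) 0 := by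
  have hx : HasDerivAt (AffineMap.lineMap x x' : ℝ → E₁) (x' - x) 0 := AffineMap.hasDerivAt_lineMap
  have hm : HasDerivAt (AffineMap.lineMap s s' : ℝ → ℝ) (s' - s) 0 := AffineMap.hasDerivAt_lineMap
  have hpersp := hasDerivAt_perspective (y := momentW wt x s) (hm.const_add 1)
    (hx.add_const wt) (by simpa using hs) (by simp [momentW]) (hP.f_differentiable _)
  have hMuTilde : HasDerivAt (fun ε : ℝ => P.momentMuTilde μt (AffineMap.lineMap x x' ε)
      (AffineMap.lineMap s s' ε)) (P.A (x' - x) - (s' - s) • P.b) 0 :=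
    ((P.A.hasFDerivAt.comp_hasDerivAt 0 hx).sub (hm.smul_const P.b)).add_const μt.snd
  have hproj := hasDerivAt_comp_of_hasGradientAt
    (hasGradientAt_projPotential hP.Q_nonempty hP.Q_closed hP.Q_convex _) hMuTilde
  refine ((hpersp.fun_add hproj).fun_add (hm.const_mul ℓ)).congr_deriv ?_
  simp only [AffineMap.lineMap_apply_zero, momentL, momentPoint, inner_oracleDir, map_sub,
    inner_sub_right, inner_smul_right, WithLp.toLp_fst, WithLp.toLp_snd]
  ring

lemma Regular.inner_sub_momentPoint_nonpos (hP : P.Regular) (hs : 0 ≤ s)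
    {μ : WithLp 2 (E₁ × E₂)} {r : ℝ} (hr : P.fstar μ.fst ≤ r) (hQ : μ.snd ∈ P.Q)
    (hL : P.momentL (μ, r) x s ≤ P.momentL (P.momentPoint μt wt x s) x s) :
    ⟪WithLp.toLp 2 (wt - momentW wt x s, μt.snd - (P.momentPoint μt wt x s).1.snd),
      μ - (P.momentPoint μt wt x s).1⟫ ≤ 0 := by
  obtain ⟨p, hp⟩ : ∃ p, p = P.momentPoint μt wt x s := ⟨_, rfl⟩
  rw [← hp] at hL ⊢
  have hp₂ : p.2 = ⟪p.1.fst, momentW wt x s⟫ - P.f (momentW wt x s) := by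
    rw [hp]
    rfl
  have hproj : ⟪P.momentMuTilde μt x s - p.1.snd, μ.snd - p.1.snd⟫ ≤ 0 := by
    rw [hp]
    exact inner_sub_projOn_nonpos hP.Q_nonempty hP.Q_closed hP.Q_convex _ hQ
  have hFY := mul_le_mul_of_nonneg_left (inner_sub_le_of_hilbertConj_le hr (momentW wt x s)) hs
  have hfst : wt - momentW wt x s = s • momentW wt x s - x := by
    have hcomb : (1 + s) • momentW wt x s = x + wt := smul_inv_smul₀ (by positivity) _
    rw [add_smul, one_smul] at hcomb
    rw [sub_eq_sub_iff_add_eq_add, add_comm wt, ← hcomb, add_comm]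
  have hsnd : μt.snd - p.1.snd
      = (P.momentMuTilde μt x s - p.1.snd) - P.A x + s • P.b := by
    rw [momentMuTilde]
    abel
  rw [WithLp.prod_inner_apply]
  change ⟪wt - momentW wt x s, μ.fst - p.1.fst⟫ + ⟪μt.snd - p.1.snd, μ.snd - p.1.snd⟫ ≤ 0
  rw [hfst, hsnd, inner_add_left, inner_sub_left _ (P.A x)]
  simp only [momentL, inner_oracleDir] at hL
  simp only [inner_sub_left (s • _), inner_sub_right _ μ.fst, inner_sub_right (P.A x),
    inner_sub_right P.b, real_inner_smul_left, real_inner_comm _ (momentW wt x s),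
    real_inner_comm _ x, real_inner_comm _ (P.A x), real_inner_comm _ P.b]
  linear_combination hproj + hFY + hL + s * hp₂

lemma Regular.momentL_sub_le_of_isMinOn (hP : P.Regular) (hs : 1 + s ≠ 0)
    (hmin : IsMinOn (fun ε : ℝ => P.momentObj μt wt ℓ (AffineMap.lineMap x x' ε)
      (AffineMap.lineMap s s' ε)) (Set.Icc 0 1) 0) :
    P.momentL (P.momentPoint μt wt x s) x' s' - ℓ * s'
      ≤ P.momentL (P.momentPoint μt wt x s) x s - ℓ * s := by
  linarith [nonneg_of_hasDerivAt_of_isMinOn_Icc (hP.hasDerivAt_momentObj hs) hmin]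

end Problem

end FirstOrder

section Optimality

variable {E₁ E₂ : Type*} [NormedAddCommGroup E₁] [InnerProductSpace ℝ E₁]
  [NormedAddCommGroup E₂] [InnerProductSpace ℝ E₂] [MeasurableSpace E₁]

namespace Problem

variable {P : Problem E₁ E₂} {μt : WithLp 2 (E₁ × E₂)} {wt : E₁} {S : Set E₁} {ℓ : ℝ}
  {ν : Measure S} [IsFiniteMeasure ν]

lemma momentObj_le_of_mem_argminOn
    (hν : -ν.toSignedMeasure ∈ argminOn (P.explObj μt wt S ℓ) {m | m ≤ 0})
    (ρ : Measure S) [IsFiniteMeasure ρ] :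
    P.momentObj μt wt ℓ (∫ v, (v : E₁) ∂ν) (ν.real Set.univ)
      ≤ P.momentObj μt wt ℓ (∫ v, (v : E₁) ∂ρ) (ρ.real Set.univ) := by
  have hle : P.explObj μt wt S ℓ (-ν.toSignedMeasure) ≤ P.explObj μt wt S ℓ (-ρ.toSignedMeasure) :=
    hν.2 (neg_toSignedMeasure_nonpos ρ)
  rwa [explObj_neg_toSignedMeasure, explObj_neg_toSignedMeasure, EReal.coe_le_coe_iff] at hle

variable [BorelSpace E₁]

lemma isMinOn_momentObj_lineMap (hS : IsCompact S)
    (hν : -ν.toSignedMeasure ∈ argminOn (P.explObj μt wt S ℓ) {m | m ≤ 0})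
    (ρ : Measure S) [IsFiniteMeasure ρ] :
    IsMinOn (fun ε : ℝ => P.momentObj μt wt ℓ
        (AffineMap.lineMap (∫ v, (v : E₁) ∂ν) (∫ v, (v : E₁) ∂ρ) ε)
        (AffineMap.lineMap (ν.real Set.univ) (ρ.real Set.univ) ε)) (Set.Icc 0 1) 0 := by
  rintro ε ⟨hε₀, hε₁⟩
  let a : NNReal := ⟨1 - ε, sub_nonneg.2 hε₁⟩
  let b : NNReal := ⟨ε, hε₀⟩
  have hle := momentObj_le_of_mem_argminOn hν (a • ν + b • ρ)
  have hmean : ∫ v, (v : E₁) ∂(a • ν + b • ρ)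
      = AffineMap.lineMap (∫ v, (v : E₁) ∂ν) (∫ v, (v : E₁) ∂ρ) ε := by
    rw [integral_add_measure (integrable_coe hS _) (integrable_coe hS _),
      integral_smul_nnreal_measure, integral_smul_nnreal_measure, AffineMap.lineMap_apply_module]
    rfl
  have hmass : (a • ν + b • ρ).real Set.univ
      = AffineMap.lineMap (ν.real Set.univ) (ρ.real Set.univ) ε := by
    rw [measureReal_add_apply, measureReal_nnreal_smul_apply, measureReal_nnreal_smul_apply,
      AffineMap.lineMap_apply_module]
    rfl
  rw [hmean, hmass] at hle
  simpa only [Set.mem_ofPred_eq, AffineMap.lineMap_apply_zero] using hle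

variable [CompleteSpace E₁] [CompleteSpace E₂]

lemma integral_primalL_sub_const (hS : IsCompact S) (p : WithLp 2 (E₁ × E₂) × ℝ)
    (ρ : Measure S) [IsFiniteMeasure ρ] :
    ∫ v, (P.primalL S p - ContinuousMap.const S ℓ) v ∂ρ
      = P.momentL p (∫ v, (v : E₁) ∂ρ) (ρ.real Set.univ) - ℓ * ρ.real Set.univ := by
  have : CompactSpace S := isCompact_iff_compactSpace.mp hS
  calc ∫ v, (P.primalL S p - ContinuousMap.const S ℓ) v ∂ρ
      = ∫ v, (P.primalL S p v - ℓ) ∂ρ := rfl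
    _ = _ := by
      rw [integral_sub (integrable_continuousMap _ ρ) (integrable_const ℓ),
        integral_primalL ρ hS, integral_const, smul_eq_mul, mul_comm ℓ]

lemma IsFeasible.momentL_le (hS : IsCompact S) {μ : WithLp 2 (E₁ × E₂)} {r : ℝ}
    (h : P.IsFeasible S ℓ μ r) (ρ : Measure S) [IsFiniteMeasure ρ] :
    P.momentL (μ, r) (∫ v, (v : E₁) ∂ρ) (ρ.real Set.univ) ≤ ℓ * ρ.real Set.univ := by
  rw [← sub_nonpos, ← integral_primalL_sub_const hS]
  exact integral_nonpos fun v => sub_nonpos.2 (h.primalL_le v)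

/-- The point `Problem.momentPoint` at the mean and the total mass of `ν`. -/
noncomputable def measurePoint (P : Problem E₁ E₂) (μt : WithLp 2 (E₁ × E₂)) (wt : E₁)
    (ν : Measure S) : WithLp 2 (E₁ × E₂) × ℝ :=
  P.momentPoint μt wt (∫ v, (v : E₁) ∂ν) (ν.real Set.univ)

variable (hP : P.Regular) (hS : IsCompact S)
  (hν : -ν.toSignedMeasure ∈ argminOn (P.explObj μt wt S ℓ) {m | m ≤ 0})

include hP hS hν

lemma Regular.integral_primalL_sub_const_le (ρ : Measure S) [IsFiniteMeasure ρ] :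
    ∫ v, (P.primalL S (P.measurePoint μt wt ν) - ContinuousMap.const S ℓ) v ∂ρ
      ≤ ∫ v, (P.primalL S (P.measurePoint μt wt ν) - ContinuousMap.const S ℓ) v ∂ν := by
  rw [integral_primalL_sub_const hS, integral_primalL_sub_const hS]
  exact hP.momentL_sub_le_of_isMinOn (by positivity) (isMinOn_momentObj_lineMap hS hν ρ)

lemma Regular.isFeasible_measurePoint :
    P.IsFeasible S ℓ (P.measurePoint μt wt ν).1 (P.measurePoint μt wt ν).2 where
  fstar_le := hP.fstar_momentPoint.le
  snd_mem := hP.momentPoint_snd_mem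
  primalL_le v := by
    have : CompactSpace S := isCompact_iff_compactSpace.mp hS
    exact sub_nonpos.1
      (nonpos_of_forall_integral_le (hP.integral_primalL_sub_const_le hS hν) v)

lemma Regular.momentL_measurePoint :
    P.momentL (P.measurePoint μt wt ν) (∫ v, (v : E₁) ∂ν) (ν.real Set.univ)
      = ℓ * ν.real Set.univ := by
  have : CompactSpace S := isCompact_iff_compactSpace.mp hS
  rw [← sub_eq_zero, ← integral_primalL_sub_const hS]
  exact integral_eq_zero_of_forall_integral_le (hP.integral_primalL_sub_const_le hS hν)

lemma Regular.explObj_eq_neg_projObj_add_shift (hw : wt ∈ subdiff P.fstar μt.fst) :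
    P.explObj μt wt S ℓ (-ν.toSignedMeasure)
      = -(P.projObj μt wt (P.measurePoint μt wt ν).1 + (P.shift μt wt : EReal)) := by
  have hF : P.primalF μt wt (P.measurePoint μt wt ν) = _ :=
    hP.primalF_momentPoint (by positivity : 1 + ν.real Set.univ ≠ 0)
  have hslack := hP.momentL_measurePoint hS hν
  have hfeas := hP.isFeasible_measurePoint hS hν
  rw [← hfeas.primalObj_eq_projObj_add_shift hP.f_convex hP.f_differentiable hw
    hP.fstar_momentPoint, hfeas.primalObj_eq_primalF, explObj_neg_toSignedMeasure, hF,
    ← EReal.coe_neg]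
  congr 1
  rw [measurePoint] at hslack
  rw [hslack, momentObj, momentObj]
  ring

lemma Regular.mem_normalCone_levelSet (hne : S.Nonempty) :
    WithLp.toLp 2 (wt - momentW wt (∫ v, (v : E₁) ∂ν) (ν.real Set.univ),
        μt.snd - (P.measurePoint μt wt ν).1.snd)
      ∈ normalCone (P.levelSet S ℓ) (P.measurePoint μt wt ν).1 := by
  refine ⟨(mem_levelSet_iff hne).2
    ⟨_, hP.fstar_momentPoint, hP.isFeasible_measurePoint hS hν⟩, fun μ hμ => ?_⟩
  obtain ⟨r, -, hfeas⟩ := (mem_levelSet_iff hne).1 hμ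
  exact hP.inner_sub_momentPoint_nonpos measureReal_nonneg hfeas.fstar_le hfeas.snd_mem
    ((hfeas.momentL_le hS ν).trans_eq (hP.momentL_measurePoint hS hν).symm)

end Problem

end Optimality

/-! ### Runs of the algorithm -/

section Run

variable {E₁ E₂ : Type*} [NormedAddCommGroup E₁] [InnerProductSpace ℝ E₁]
  [NormedAddCommGroup E₂] [InnerProductSpace ℝ E₂] {P : Problem E₁ E₂}

lemma Problem.Regular.nextW_mem_subdiff [CompleteSpace E₁] [MeasurableSpace E₁] (hP : P.Regular)
    (μt : WithLp 2 (E₁ × E₂)) (wt : E₁) {S : Set E₁} (m : SignedMeasure S) :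
    nextW wt S m ∈ subdiff P.fstar (P.nextMu μt wt S m).fst :=
  (mem_subdiff_hilbertConj_iff hP.f_convex (hP.f_differentiable _)).2 rfl

lemma norm_nextW_le [MeasurableSpace E₁] {S : Set E₁} {D : ℝ} (hS : ∀ v ∈ S, ‖v‖ ≤ D) {wt : E₁}
    (hw : ‖wt‖ ≤ D) {m : SignedMeasure S} (hm : m ≤ 0) : ‖Problem.nextW wt S m‖ ≤ D := by
  obtain ⟨ν, _, rfl⟩ := exists_eq_neg_toSignedMeasure hm
  have hmean : ‖∫ v, (v : E₁) ∂ν‖ ≤ D * ν.real Set.univ :=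
    norm_integral_le_of_norm_le_const (.of_forall fun v => hS v v.2)
  have hmass : 0 < 1 + ν.real Set.univ := by positivity
  rw [Problem.nextW_neg_toSignedMeasure, Problem.momentW, norm_smul, norm_inv,
    Real.norm_of_nonneg hmass.le, inv_mul_le_iff₀ hmass]
  linarith [norm_add_le (∫ v, (v : E₁) ∂ν) wt]

variable [CompleteSpace E₁] [CompleteSpace E₂]

lemma Problem.Standing.regular (hP : P.Standing) : P.Regular where
  f_convex := hP.f_convex
  f_differentiable := hP.f_differentiable
  Q_nonempty := hP.Q_nonempty
  Q_closed := isClosed_add_of_isBounded hP.Q₁_closed hP.Q₁_convex hP.Q₁_bounded hP.Q₂_closed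
    hP.Q₂_convex
  Q_convex := hP.Q₁_convex.add hP.Q₂_convex

lemma Problem.Standing.Kinit_nonempty (hP : P.Standing) : P.Kinit.Nonempty := by
  obtain ⟨-, -, -, ⟨z, hz, -⟩, -⟩ := Set.mem_sub.1 (interior_subset hP.qualification)
  exact convexHull_nonempty_iff.1 (closure_nonempty_iff.1 ⟨z, hz⟩)

variable [MeasurableSpace E₁] {lam : ℝ} {R : Iterates E₁ E₂} {T : ℕ∞} {t : ℕ}

namespace IsRun

lemma cuts_induction (hR : IsRun P lam R T) {p : Set E₁ → Prop} (init : p P.Kinit)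
    (add_cut : ∀ t : ℕ, (t : ℕ∞) ≤ T → p (R.Kprev t) → p (R.Kprev t ∪ {-R.v t}))
    (prune : ∀ t : ℕ, (t : ℕ∞) ≤ T → p (R.Kprev t) → ∀ S ⊆ R.hull t, P.IsSimple S → p S)
    (ht : (t : ℕ∞) ≤ T) : p (R.cuts t) := by
  have step (t : ℕ) (ht : (t : ℕ∞) ≤ T) (h : p (R.Kprev t)) : p (R.cuts t) := by
    by_cases hgap : ((R.gap t : ℝ) : EReal) < ((1 - lam : ℝ) : EReal) * R.gapRef t
    · obtain ⟨hhull, hsimple, -, -⟩ := hR.prune t ht hgap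
      exact prune t ht h _ hhull hsimple
    · rw [(hR.no_prune t ht hgap).1]
      exact add_cut t ht h
  refine step t ht ?_
  induction t with
  | zero => exact hR.init_cuts ▸ init
  | succ t ih =>
    have ht' : (t : ℕ∞) ≤ T := (Nat.cast_le.2 t.le_succ).trans ht
    exact step t ht' (ih ht')

lemma isCompact_cuts (hR : IsRun P lam R T) (hK : IsCompact P.Kinit) (ht : (t : ℕ∞) ≤ T) :
    IsCompact (R.cuts t) := by
  refine hR.cuts_induction hK (fun t _ h => h.union isCompact_singleton) ?_ ht
  rintro t - - - - ⟨J, hJ, rfl⟩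
  exact hK.union hJ.isCompact

lemma Kinit_subset_cuts (hR : IsRun P lam R T) (ht : (t : ℕ∞) ≤ T) : P.Kinit ⊆ R.cuts t := by
  refine hR.cuts_induction subset_rfl (fun t _ h => h.trans Set.subset_union_left) ?_ ht
  rintro t - - - - ⟨J, -, rfl⟩
  exact Set.subset_union_left

lemma cuts_subset (hR : IsRun P lam R T) {B : Set E₁} (hcl : IsClosed B) (hco : Convex ℝ B)
    (hK : P.Kinit ⊆ B) (hv : ∀ t : ℕ, (t : ℕ∞) ≤ T → -R.v t ∈ B) (ht : (t : ℕ∞) ≤ T) :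
    R.cuts t ⊆ B := by
  have hunion (t : ℕ) (ht : (t : ℕ∞) ≤ T) (h : R.Kprev t ⊆ B) : R.Kprev t ∪ {-R.v t} ⊆ B :=
    Set.union_subset h (Set.singleton_subset_iff.2 (hv t ht))
  exact hR.cuts_induction hK hunion (fun t ht h S hS _ =>
    hS.trans (closure_minimal (convexHull_min (hunion t ht h) hco) hcl)) ht

lemma w_mem_subdiff (hR : IsRun P lam R T) (hP : P.Regular) (ht : (t : ℕ∞) ≤ T) :
    R.w t ∈ subdiff P.fstar (R.μ t).fst := by
  cases t with
  | zero => exact hR.init_w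
  | succ t =>
    have ht' : (t : ℕ∞) < T := (Nat.cast_lt.2 t.lt_succ_self).trans_le ht
    rw [hR.w_succ t ht', hR.μ_succ t ht']
    exact hP.nextW_mem_subdiff _ _ _

lemma norm_w_le (hR : IsRun P lam R T) {D : ℝ} (hK : ∀ x ∈ P.Kinit, ‖x‖ ≤ D)
    (hv : ∀ t : ℕ, (t : ℕ∞) ≤ T → ‖R.v t‖ ≤ D) (hw : ‖R.w 0‖ ≤ D) (ht : (t : ℕ∞) ≤ T) :
    ‖R.w t‖ ≤ D := by
  induction t with
  | zero => exact hw
  | succ t ih =>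
    have ht' : (t : ℕ∞) < T := (Nat.cast_lt.2 t.lt_succ_self).trans_le ht
    have hcuts : R.cuts t ⊆ Metric.closedBall 0 D :=
      hR.cuts_subset Metric.isClosed_closedBall (convex_closedBall 0 D)
        (fun x hx => mem_closedBall_zero_iff.2 (hK x hx))
        (fun u hu => by rw [mem_closedBall_zero_iff, norm_neg]; exact hv u hu) ht'.le
    rw [hR.w_succ t ht']
    exact norm_nextW_le (fun v hv => mem_closedBall_zero_iff.1 (hcuts hv)) (ih ht'.le)
      (hR.candidate t ht').1

lemma exists_norm_w_le (hR : IsRun P lam R T) (hK : Bornology.IsBounded P.Kinit)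
    (hv : ∃ C : ℝ, ∀ t : ℕ, (t : ℕ∞) ≤ T → ‖R.v t‖ ≤ C) :
    ∃ C : ℝ, ∀ t : ℕ, (t : ℕ∞) ≤ T → ‖R.w t‖ ≤ C := by
  obtain ⟨C₀, hC₀⟩ := hK.exists_norm_le
  obtain ⟨C₁, hC₁⟩ := hv
  refine ⟨max (max C₀ C₁) ‖R.w 0‖, fun t ht => hR.norm_w_le (fun x hx => ?_) (fun u hu => ?_)
    (le_max_right _ _) ht⟩
  · exact (hC₀ x hx).trans ((le_max_left _ _).trans (le_max_left _ _))
  · exact (hC₁ u hu).trans ((le_max_right _ _).trans (le_max_left _ _))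

end IsRun

end Run

end DLS

theorem mainTheorem5_general {E₁ E₂ : Type*}
    [NormedAddCommGroup E₁] [InnerProductSpace ℝ E₁] [CompleteSpace E₁]
    [NormedAddCommGroup E₂] [InnerProductSpace ℝ E₂] [CompleteSpace E₂]
    [MeasurableSpace E₁] [BorelSpace E₁] (P : Problem E₁ E₂) :
    (P.Regular → ∀ μt wt (S : Set E₁) (ℓ : ℝ), wt ∈ subdiff P.fstar μt.fst →
      IsCompact S → S.Nonempty →
      ∀ m : SignedMeasure S, m ∈ argminOn (P.explObj μt wt S ℓ) {m | m ≤ 0} →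
      ((⨅ p, fenchelPrimalObj (P.primalF μt wt) (primalG S ℓ) (P.primalL S) p)
          = (⨅ μ ∈ P.levelSet S ℓ, P.projObj μt wt μ) + (P.shift μt wt : EReal)
        ∧ (∀ μ z, (μ, z) ∈ argminOn
              (fenchelPrimalObj (P.primalF μt wt) (primalG S ℓ) (P.primalL S)) Set.univ ↔
            (z : EReal) = P.fstar μ.fst ∧ μ ∈ argminOn (P.projObj μt wt) (P.levelSet S ℓ))
        ∧ (∀ m' : SignedMeasure S, ∃ φ : StrongDual ℝ C(S, ℝ), Represents φ m')
        ∧ (∀ (φ : StrongDual ℝ C(S, ℝ)) (m₁ m₂ : SignedMeasure S),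
            Represents φ m₁ → Represents φ m₂ → m₁ = m₂)
        ∧ (∀ (φ : StrongDual ℝ C(S, ℝ)) (m' : SignedMeasure S), Represents φ m' →
            fenchelDualObj (P.primalF μt wt) (primalG S ℓ) (P.primalL S) φ
              = P.explObj μt wt S ℓ m' + ind {m | m ≤ 0} m')
        ∧ (∀ φ : StrongDual ℝ C(S, ℝ),
            fenchelDualObj (P.primalF μt wt) (primalG S ℓ) (P.primalL S) φ ≠ ⊤ →
            ∃ m' : SignedMeasure S, m' ≤ 0 ∧ Represents φ m')
        ∧ (⨅ m' ∈ {m : SignedMeasure S | m ≤ 0}, P.explObj μt wt S ℓ m')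
            = -((⨅ μ ∈ P.levelSet S ℓ, P.projObj μt wt μ) + (P.shift μt wt : EReal)))
      ∧ argminOn (P.projObj μt wt) (P.levelSet S ℓ) = {P.nextMu μt wt S m}
      ∧ Problem.nextW wt S m ∈ subdiff P.fstar (P.nextMu μt wt S m).fst
      ∧ WithLp.toLp 2 (wt - Problem.nextW wt S m, μt.snd - (P.nextMu μt wt S m).snd)
          ∈ normalCone (P.levelSet S ℓ) (P.nextMu μt wt S m)) ∧
    (∀ (lam : ℝ) (R : Iterates E₁ E₂) (T : ℕ∞), IsRun P lam R T → Bornology.IsBounded P.Kinit →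
      (∃ C : ℝ, ∀ t : ℕ, (t : ℕ∞) ≤ T → ‖R.v t‖ ≤ C) →
      ∃ C : ℝ, ∀ t : ℕ, (t : ℕ∞) ≤ T → ‖R.w t‖ ≤ C) := by
  refine ⟨?_, fun lam R T hR => hR.exists_norm_w_le⟩
  intro hP μt wt S ℓ hw hS hne m hm
  have hc := hP.f_convex
  have hd := hP.f_differentiable
  have hsub := hP.nextW_mem_subdiff μt wt m
  obtain ⟨ν, _, rfl⟩ := exists_eq_neg_toSignedMeasure hm.1
  have hnext : P.nextMu μt wt S (-ν.toSignedMeasure) = (P.measurePoint μt wt ν).1 :=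
    Problem.nextMu_neg_toSignedMeasure ν
  have hnormal := hP.mem_normalCone_levelSet hS hm hne
  rw [← hnext, ← Problem.nextW_neg_toSignedMeasure] at hnormal
  have hunique := Problem.argminOn_projObj_of_mem_normalCone hc hd hw hsub hnormal
  have hmin : P.nextMu μt wt S (-ν.toSignedMeasure)
      ∈ argminOn (P.projObj μt wt) (P.levelSet S ℓ) := hunique ▸ Set.mem_singleton _
  refine ⟨⟨Problem.iInf_primalObj_eq hc hd hw hne hmin,
    fun μ z => Problem.mem_argminOn_primalObj_iff hc hd hw hne ⟨_, hmin.1⟩,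
    exists_represents hS, fun φ m₁ m₂ => represents_unique hS,
    fun φ m' => hP.fenchelDualObj_eq_explObj_add_ind hS,
    fun φ => hP.exists_represents_of_fenchelDualObj_ne_top hS, ?_⟩, hunique, hsub, hnormal⟩
  rw [iInf_eq_of_mem_argminOn hm, iInf_eq_of_mem_argminOn hmin,
    hP.explObj_eq_neg_projObj_add_shift hS hm hw, hnext]

theorem mainTheorem5 {E₁ E₂ : Type*}
    [NormedAddCommGroup E₁] [InnerProductSpace ℝ E₁] [CompleteSpace E₁]
    [NormedAddCommGroup E₂] [InnerProductSpace ℝ E₂] [CompleteSpace E₂]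
    [MeasurableSpace E₁] [BorelSpace E₁]
    (P : Problem E₁ E₂) (hP : P.Standing) (lam : ℝ) (R : Iterates E₁ E₂) (T : ℕ∞)
    (hR : IsRun P lam R T) :
    (∀ t : ℕ, (t : ℕ∞) ≤ T → ∀ μt wt S ℓ, μt = R.μ t → wt = R.w t → S = R.cuts t →
      ℓ = R.level lam t →
      ∀ m : SignedMeasure S, m ∈ argminOn (P.explObj μt wt S ℓ) {m | m ≤ 0} →
      -- up to the shift, the projection problem is `minimize F p + G (L p)`
      ((⨅ p, fenchelPrimalObj (P.primalF μt wt) (primalG S ℓ) (P.primalL S) p)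
          = (⨅ μ ∈ P.levelSet S ℓ, P.projObj μt wt μ) + (P.shift μt wt : EReal)
        ∧ (∀ μ z, (μ, z) ∈ argminOn
              (fenchelPrimalObj (P.primalF μt wt) (primalG S ℓ) (P.primalL S)) Set.univ ↔
            (z : EReal) = P.fstar μ.fst ∧ μ ∈ argminOn (P.projObj μt wt) (P.levelSet S ℓ))
      -- the Fenchel dual of `minimize F p + G (L p)` is the explicit measure-valued problem
        ∧ (∀ m' : SignedMeasure S, ∃ φ : StrongDual ℝ C(S, ℝ), Represents φ m')
        ∧ (∀ (φ : StrongDual ℝ C(S, ℝ)) (m₁ m₂ : SignedMeasure S),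
            Represents φ m₁ → Represents φ m₂ → m₁ = m₂)
        ∧ (∀ (φ : StrongDual ℝ C(S, ℝ)) (m' : SignedMeasure S), Represents φ m' →
            fenchelDualObj (P.primalF μt wt) (primalG S ℓ) (P.primalL S) φ
              = P.explObj μt wt S ℓ m' + ind {m | m ≤ 0} m')
        ∧ (∀ φ : StrongDual ℝ C(S, ℝ),
            fenchelDualObj (P.primalF μt wt) (primalG S ℓ) (P.primalL S) φ ≠ ⊤ →
            ∃ m' : SignedMeasure S, m' ≤ 0 ∧ Represents φ m')
      -- the two values are opposite, up to the shift
        ∧ (⨅ m' ∈ {m : SignedMeasure S | m ≤ 0}, P.explObj μt wt S ℓ m')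
            = -((⨅ μ ∈ P.levelSet S ℓ, P.projObj μt wt μ) + (P.shift μt wt : EReal)))
      -- the updates solve the projection problem
      ∧ argminOn (P.projObj μt wt) (P.levelSet S ℓ) = {P.nextMu μt wt S m}
      -- and satisfy the subgradient and normal cone conditions
      ∧ Problem.nextW wt S m ∈ subdiff P.fstar (P.nextMu μt wt S m).fst
      ∧ WithLp.toLp 2 (wt - Problem.nextW wt S m, μt.snd - (P.nextMu μt wt S m).snd)
          ∈ normalCone (P.levelSet S ℓ) (P.nextMu μt wt S m)) ∧
    (OracleAssumption P R T → ∃ C : ℝ, ∀ t : ℕ, (t : ℕ∞) ≤ T → ‖R.w t‖ ≤ C) := by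
  obtain ⟨hstep, hbound⟩ := mainTheorem5_general P
  refine ⟨?_, fun ⟨_, C, hC⟩ => hbound lam R T hR hP.Kinit_compact.isBounded
    ⟨C, fun t ht => (WithLp.norm_fst_le _ _).trans (hC t ht)⟩⟩
  rintro t ht _ _ _ _ rfl rfl rfl rfl
  exact hstep hP.regular _ _ _ _ (hR.w_mem_subdiff hP.regular ht)
    (hR.isCompact_cuts hP.Kinit_compact ht) (hP.Kinit_nonempty.mono (hR.Kinit_subset_cuts ht))
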